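/- **Setting.** Let $d\ge 1$, let $I\subset\mathbb R$ be an interval with more than one point, and let $\eta(t,\cdot):\mathbb R^d\to\mathbb R$, $t\in I$, be Lipschitz functions. Each rigid boundary $\Gamma^\pm$ is either empty or the graph of a Lipschitz function $b^\pm:\mathbb R^d\to\mathbb R$, and for each $t\in I$ the graph $\Sigma_t$ of $\eta(t)$ satisfies $\inf_x(\eta(t,x)-b^-(x))>0$, resp. $\inf_x(b^+(x)-\eta(t,x))>0$. Put $\Omega_t^-=\{b^-(x)<y<\eta(t,x)\}$ and $\Omega_t^+=\{\eta(t,x)<y<b^+(x)\}$ (no condition involving $b^\pm$ if $\Gamma^\pm=\emptyset$), and let $n=(1+|\nabla\eta|^2)^{-1/2}(-\nabla\eta,1)$ be the upward unit normal. For an open set $U$ let $\dot H^1(U)=\{\phi\in L^2_{loc}(\overline U):\nabla\phi\in L^2(U)\}$. A *Darcy flow* in $\Omega_t^\pm$ with viscosity $\mu^\pm$ and density $\rho^\pm$ is a pair $(u^\pm,p^\pm)$ with $u^\pm\in L^2(\Omega_t^\pm)$ (in the case $\Gamma^\pm=\emptyset$ this expresses the vanishing of $u^\pm$ at infinity), $p^\pm\in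 H^1_{loc}(\overline{\Omega_t^\pm})$, $\mu^\pm u^\pm+\nabla_{x,y}p^\pm=-(0,\rho^\pm)$ and $\operatorname{div}u^\pm=0$ in $\Omega_t^\pm$, and $u^\pm\cdot\nu^\pm=0$ on $\Gamma^\pm$ weakly, i.e. $\int_{\Omega^\pm_t}u^\pm\cdot\nabla w=0$ for all $w\in\dot H^1(\Omega_t^\pm)$ with bounded support and $w|_{\Sigma_t}=0$. Traces on $\Sigma_t$ are functions of $x\in\mathbb R^d$, normal traces $\sqrt{1+|\nabla\eta|^2}\,u\cdot n|_{\Sigma_t}$ are distributions on $\mathbb R^d$, both defined by Green's formula, and $\partial_t\eta(t)$ is the derivative at $t$ in $I$ of $\tau\mapsto\eta(\tau)$ in the sense of distributions on $\mathbb R^d$, i.e. tested against each fixed $\psi\in C_c^\infty(\mathbb R^d)$. * $(u,p,\eta)$ solves the *one-phase Muskat problem* on $I$ if for all $t\in I$: $(u(t),p(t))$ is a Darcy flow in $\Omega^-_t$, $p=0$ on $\Sigma_t$, and $\partial_t\eta=\sqrt{1+|\nabla\eta|^2}\,u\cdot n|_{\Sigma_t}$. * $(u^\pm,p^\pm,\eta)$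 solves the *two-phase Muskat problem* on $I$ if for all $t\in I$: $(u^\pm(t),p^\pm(t))$ are Darcy flows in $\Omega^\pm_t$, $u^+\cdot n=u^-\cdot n$ (equality of normal traces) and $p^+=p^-$ on $\Sigma_t$, and $\partial_t\eta=\sqrt{1+|\nabla\eta|^2}\,u^-\cdot n|_{\Sigma_t}$. *Dirichlet–Neumann operators.* Fix $t$ and let $f$ belong to the domain of $G^\pm(\eta)$, that is, let $f$ be the trace on $\Sigma_t$ of a function in $\dot H^1(\Omega^\pm_t)$. Let $\phi^\pm\in\dot H^1(\Omega_t^\pm)$ be the variational solution of $\Delta\phi^\pm=0$ in $\Omega^\pm_t$, $\phi^\pm=f$ on $\Sigma_t$, $\partial\phi^\pm/\partial\nu^\pm=0$ on $\Gamma^\pm$, i.e. $\phi^\pm|_{\Sigma_t}=f$ and $\int_{\Omega_t^\pm}\nabla\phi^\pm\cdot\nabla w=0$ for all $w\in\dot H^1(\Omega_t^\pm)$ with $w|_{\Sigma_t}=0$. Then $G^\pm(\eta)f=\sqrt{1+|\nabla\eta|^2}\,\partial\phi^\pm/\partial n|_{\Sigma_t}$. An equation involving $G^\pm(\eta)f$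 includes the assertion that $f$ is in the domain of $G^\pm(\eta)$. **Proposition 2.1.** (i) Let $\mu^->0$, $\rho^->0$ and $\kappa=\rho^- /\mu^-$. If $(u,p,\eta)$ solves the one-phase Muskat problem on $I$, then $$\partial_t\eta+\kappa\,G^-(\eta)\eta=0\quad\text{for all }t\in I.\tag{1}$$ Conversely, if $\eta$ satisfies (1), then there are $u,p$ such that $(u,p,\eta)$ solves the one-phase Muskat problem on $I$. (ii) Let $\mu^\pm>0$ and $\rho^\pm\in\mathbb R$. If $(u^\pm,p^\pm,\eta)$ solves the two-phase Muskat problem on $I$, then $f^\pm:=p^\pm|_{\Sigma_t}+\rho^\pm\eta$ satisfy, for all $t\in I$, $$\partial_t\eta=-\frac1{\mu^-}G^-(\eta)f^-,\tag{2}$$ $$f^+-f^-=(\rho^+-\rho^-)\eta\ \text{ a.e.},\qquad \frac1{\mu^+}G^+(\eta)f^+-\frac1{\mu^-}G^-(\eta)f^-=0.\tag{3}$$ Conversely, if $\eta$ and some functions $f^\pm(t,\cdot)$, $t\in I$, satisfy (2) and (3) for all $t\in I$, then there are $u^\pm,p^\pm$ such that $(u^\pm,p^\pm,\eta)$ solves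 the two-phase Muskat problem on $I$. -/

import Mathlib

open MeasureTheory Set
open scoped ContDiff

noncomputable section

namespace Muskat

/-- The horizontal space `ℝ^d` with its Euclidean structure. -/
abbrev Hor (d : ℕ) : Type := EuclideanSpace ℝ (Fin d)

/-- The ambient space `ℝ^d × ℝ`; a point is `z = (x, y)`. Its measure is Lebesgue measure. -/
abbrev Amb (d : ℕ) : Type := Hor d × ℝ

variable {d : ℕ}

/-- The Euclidean inner product of `ℝ^d × ℝ`. -/
def dot (v w : Amb d) : ℝ := inner ℝ v.1 w.1 + v.2 * w.2

/-- Smooth compactly supported functions. -/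
def IsTest {X : Type*} [NormedAddCommGroup X] [NormedSpace ℝ X] (Φ : X → ℝ) : Prop :=
  ContDiff ℝ ∞ Φ ∧ HasCompactSupport Φ

/-- Test functions on `ℝ^d`; real functions on this type are used as distributions on `ℝ^d`. -/
abbrev HorTest (d : ℕ) : Type := {ψ : Hor d → ℝ // IsTest ψ}

/-- The two sides of the interface. -/
inductive Phase
  | lower
  | upper

/-- `-1` for the lower fluid, `+1` for the upper one. -/
def Phase.sign : Phase → ℝ
  | .lower => -1
  | .upper => 1

/-- The rigid boundary, a graph, or empty (`none`, infinite depth). -/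
def wall (b : Option (Hor d → ℝ)) : Set (Amb d) := {z | ∃ b₀ ∈ b, z.2 = b₀ z.1}

/-- The region between the interface `y = η(x)` and the rigid boundary:
`{η < y < b}` for the upper fluid, `{b < y < η}` for the lower one; if there is no rigid boundary,
`{η < y}` and `{y < η}` respectively. -/
def Phase.domain (s : Phase) (b : Option (Hor d → ℝ)) (η : Hor d → ℝ) : Set (Amb d) :=
  {z | 0 < s.sign * (z.2 - η z.1) ∧ ∀ b₀ ∈ b, 0 < s.sign * (b₀ z.1 - z.2)}

/-- The geometric standing assumptions at a fixed time: the interface is a Lipschitz graph, the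
rigid boundary of the phase is empty or a Lipschitz graph, and the two are separated by a positive
distance, the fluid lying between them. -/
structure Admissible (s : Phase) (b : Option (Hor d → ℝ)) (η : Hor d → ℝ) : Prop where
  lipschitz_interface : ∃ K, LipschitzWith K η
  lipschitz_wall : ∀ b₀ ∈ b, ∃ K, LipschitzWith K b₀
  separated : ∃ h > 0, ∀ b₀ ∈ b, ∀ x, h ≤ s.sign * (b₀ x - η x)

/-- `F` is the weak gradient of `φ` in the open set `Ω`. -/
def HasWeakGradient (Ω : Set (Amb d)) (φ : Amb d → ℝ) (F : Amb d → Amb d) : Prop :=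
  ∀ Φ : Amb d → ℝ, IsTest Φ → tsupport Φ ⊆ Ω → ∀ v : Amb d,
    ∫ z in Ω, φ z * fderiv ℝ Φ z v = -∫ z in Ω, dot (F z) v * Φ z

/-- `φ` has weak gradient `F` in `Ω`, and both are square integrable on bounded subsets of `Ω`. -/
structure IsH1Loc (Ω : Set (Amb d)) (φ : Amb d → ℝ) (F : Amb d → Amb d) : Prop where
  memLp : ∀ R : ℝ, MemLp φ 2 (volume.restrict (Ω ∩ Metric.ball 0 R))
  memLp_grad : ∀ R : ℝ, MemLp F 2 (volume.restrict (Ω ∩ Metric.ball 0 R))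
  weakGradient : HasWeakGradient Ω φ F

/-- `φ` belongs to the homogeneous space `Ḣ¹(Ω)`, with gradient `F ∈ L²(Ω)`. -/
structure IsFiniteEnergy (Ω : Set (Amb d)) (φ : Amb d → ℝ) (F : Amb d → Amb d) : Prop where
  isH1Loc : IsH1Loc Ω φ F
  memLp_grad : MemLp F 2 (volume.restrict Ω)

/-- `φ = f` on the interface, in the sense of traces: Green's formula in the vertical direction,
`∫_Ω ∂_y(φ Φ) = ± ∫ f(x) Φ(x, η(x)) dx` (`+` for the lower, `-` for the upper fluid), holds for
all test functions `Φ` that vanish near the rigid boundary. -/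
def HasTrace (s : Phase) (b : Option (Hor d → ℝ)) (η : Hor d → ℝ)
    (φ : Amb d → ℝ) (f : Hor d → ℝ) : Prop :=
  LocallyIntegrable f volume ∧
  ∃ F : Amb d → Amb d, IsH1Loc (s.domain b η) φ F ∧
    ∀ Φ : Amb d → ℝ, IsTest Φ → Disjoint (tsupport Φ) (wall b) →
      ∫ z in s.domain b η, ((F z).2 * Φ z + φ z * fderiv ℝ Φ z (0, 1)) =
        -s.sign * ∫ x, f x * Φ (x, η x)

/-- `div F = 0` in `Ω`, in the sense of distributions. -/
def IsDivFree (Ω : Set (Amb d)) (F : Amb d → Amb d) : Prop :=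
  ∀ Φ : Amb d → ℝ, IsTest Φ → tsupport Φ ⊆ Ω → ∫ z in Ω, fderiv ℝ Φ z (F z) = 0

/-- Weak form of `F · ν = 0` on the rigid boundary, for a square integrable divergence free field
`F`: `∫_Ω F · ∇w = 0` for all `w ∈ Ḣ¹(Ω)` with bounded support and zero trace on the interface
(if the rigid boundary is empty, this only repeats `div F = 0`). -/
def IsImpermeable (s : Phase) (b : Option (Hor d → ℝ)) (η : Hor d → ℝ)
    (F : Amb d → Amb d) : Prop :=
  ∀ (w : Amb d → ℝ) (W : Amb d → Amb d), IsFiniteEnergy (s.domain b η) w W →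
    Bornology.IsBounded (Function.support w) → HasTrace s b η w 0 →
    ∫ z in s.domain b η, dot (F z) (W z) = 0

/-- `Ψ` is a test function on `ℝ^d × ℝ` that vanishes near the rigid boundary and equals `ψ` on
the interface. -/
def IsExtension (b : Option (Hor d → ℝ)) (η ψ : Hor d → ℝ) (Ψ : Amb d → ℝ) : Prop :=
  IsTest Ψ ∧ Disjoint (tsupport Ψ) (wall b) ∧ ∀ x, Ψ (x, η x) = ψ x

open scoped Manifold in
/-- Extensions exist as soon as the interface is away from the rigid boundary. -/
theorem exists_isExtension {s : Phase} {b : Option (Hor d → ℝ)} {η : Hor d → ℝ}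
    (h : Admissible s b η) (ψ : HorTest d) : ∃ Ψ, IsExtension b η ψ.1 Ψ := by
  obtain ⟨ψ, hψ, hψc⟩ := ψ
  obtain ⟨K, hη⟩ := h.lipschitz_interface
  have hcl : IsClosed (wall b) := by
    rcases b with _ | b₀
    · simp [wall]
    · obtain ⟨L, hb⟩ := h.lipschitz_wall b₀ rfl
      have := hb.continuous
      simpa [wall] using isClosed_eq (continuous_snd) (hb.continuous.comp continuous_fst)
  have hK : IsCompact ((fun x : Hor d => ((x, η x) : Amb d)) '' tsupport ψ) :=
    IsCompact.image hψc (continuous_id.prodMk hη.continuous)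
  have hsub : (fun x : Hor d => ((x, η x) : Amb d)) '' tsupport ψ ⊆ (wall b)ᶜ := by
    rintro _ ⟨x, -, rfl⟩ ⟨b₀, hb₀, hx⟩
    obtain ⟨r, hr, hsep⟩ := h.separated
    have := hsep b₀ hb₀ x
    simp only at hx
    rw [← hx, sub_self, mul_zero] at this
    linarith
  obtain ⟨δ, hδ, hδs⟩ := hK.exists_cthickening_subset_open hcl.isOpen_compl hsub
  obtain ⟨f, hf, -, hf0, hf1⟩ := exists_contMDiff_zero_iff_one_iff_of_isClosed (n := (⊤ : ℕ∞))
    𝓘(ℝ, Amb d) (Metric.isOpen_thickening (δ := δ)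
      (E := (fun x : Hor d => ((x, η x) : Amb d)) '' tsupport ψ)).isClosed_compl hK.isClosed
    (disjoint_compl_left_iff_subset.2 (Metric.self_subset_thickening hδ _))
  have hts : tsupport (fun z : Amb d => f z * ψ z.1) ⊆
      Metric.cthickening δ ((fun x : Hor d => ((x, η x) : Amb d)) '' tsupport ψ) := by
    refine closure_minimal ?_ Metric.isClosed_cthickening
    intro z hz
    refine Metric.thickening_subset_cthickening _ _ ?_
    by_contra hzn
    exact hz (by simp [(hf0 z).1 hzn])
  refine ⟨fun z => f z * ψ z.1, ⟨hf.contDiff.mul (hψ.comp contDiff_fst), ?_⟩, ?_, ?_⟩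
  · exact hK.cthickening.of_isClosed_subset (isClosed_tsupport _) hts
  · exact (disjoint_compl_left (a := wall b)).mono_left (hts.trans hδs)
  · intro x
    by_cases hx : x ∈ tsupport ψ
    · simp [(hf1 (x, η x)).1 ⟨x, hx, rfl⟩]
    · simp [image_eq_zero_of_notMem_tsupport hx]

/-- A choice of an extension of `ψ` (see `exists_isExtension`). -/
def extension (b : Option (Hor d → ℝ)) (η ψ : Hor d → ℝ) : Amb d → ℝ :=
  Classical.epsilon (IsExtension b η ψ)

/-- The trace `√(1+|∇η|²) F · n` on the interface, `n` the upward unit normal, of a square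
integrable divergence free field `F`, as a distribution on `ℝ^d`. By Green's formula it is
`± ∫_Ω F · ∇Ψ` for any extension `Ψ` of `ψ` (`+` for the lower fluid, for which `n` points
outward, and `-` for the upper one); the value does not depend on the extension, since two of them
differ by a function vanishing on the interface. -/
def normalTrace (s : Phase) (b : Option (Hor d → ℝ)) (η : Hor d → ℝ)
    (F : Amb d → Amb d) : HorTest d → ℝ := fun ψ =>
  -s.sign * ∫ z in s.domain b η, fderiv ℝ (extension b η ψ) z (F z)

/-- `φ`, with gradient `F`, is the variational solution in `Ḣ¹(Ω)` of `Δφ = 0` in `Ω`, `φ = f` on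
the interface, `∂φ/∂ν = 0` on the rigid boundary (`∇φ → 0` at infinity, if it is empty):
`∫_Ω ∇φ · ∇w = 0` for all `w ∈ Ḣ¹(Ω)` with zero trace on the interface. -/
structure IsDirichletSolution (s : Phase) (b : Option (Hor d → ℝ)) (η f : Hor d → ℝ)
    (φ : Amb d → ℝ) (F : Amb d → Amb d) : Prop where
  finiteEnergy : IsFiniteEnergy (s.domain b η) φ F
  trace : HasTrace s b η φ f
  variational : ∀ (w : Amb d → ℝ) (W : Amb d → Amb d), IsFiniteEnergy (s.domain b η) w W →
    HasTrace s b η w 0 → ∫ z in s.domain b η, dot (F z) (W z) = 0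

/-- The gradient of the variational solution with boundary value `f` (unique a.e.: the difference
of two solutions is an admissible `w` in the variational formulation). -/
def potentialGradient (s : Phase) (b : Option (Hor d → ℝ)) (η f : Hor d → ℝ) : Amb d → Amb d :=
  Classical.epsilon fun F => ∃ φ, IsDirichletSolution s b η f φ F

/-- The domain of the Dirichlet-Neumann operator: traces on the interface of functions in
`Ḣ¹(Ω)`. -/
def InDomain (s : Phase) (b : Option (Hor d → ℝ)) (η f : Hor d → ℝ) : Prop :=
  ∃ φ F, IsFiniteEnergy (s.domain b η) φ F ∧ HasTrace s b η φ f

/-- The Dirichlet-Neumann operator `G^±(η) f = √(1+|∇η|²) ∂φ/∂n`, `n` the upward normal, with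
values in the distributions on `ℝ^d`. It is meaningful for `f` with `InDomain s b η f`; every
equation below that involves it also asserts this. -/
def dirichletNeumann (s : Phase) (b : Option (Hor d → ℝ)) (η f : Hor d → ℝ) : HorTest d → ℝ :=
  normalTrace s b η (potentialGradient s b η f)

/-- At time `t ∈ I`, `∂_t η = v` in the sense of distributions on `ℝ^d`
(one-sided derivative if `t` is an end point of `I`). -/
def HasTimeDeriv (I : Set ℝ) (η : ℝ → Hor d → ℝ) (t : ℝ) (v : HorTest d → ℝ) : Prop :=
  ∀ ψ : HorTest d, HasDerivWithinAt (fun τ => ∫ x, η τ x * ψ.1 x) (v ψ) I t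

/-- At a fixed time, `(u, p)` is a finite energy flow in the region `Ω` of one phase: `u ∈ L²(Ω)` (in
which sense `u` vanishes at infinity), Darcy's law `μ u + ∇p = -(0, ρ)` and `div u = 0` in `Ω`, and
no penetration at the rigid boundary. -/
structure IsDarcyFlow (s : Phase) (b : Option (Hor d → ℝ)) (η : Hor d → ℝ) (μ ρ : ℝ)
    (u : Amb d → Amb d) (p : Amb d → ℝ) : Prop where
  memLp : MemLp u 2 (volume.restrict (s.domain b η))
  darcy : ∃ P, IsH1Loc (s.domain b η) p P ∧
    ∀ᵐ z ∂(volume.restrict (s.domain b η)), μ • u z + P z = -((0, ρ) : Amb d)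
  divFree : IsDivFree (s.domain b η) u
  noPenetration : IsImpermeable s b η u

/-- `(u, p, η)` solves the one-phase Muskat problem on the time interval `I`: at each time, the
flow below the interface obeys Darcy's law, the pressure vanishes on the interface, and the
interface moves with the fluid, `∂_t η = √(1+|∇η|²) u · n`. -/
def SolvesOnePhase (μ ρ : ℝ) (b : Option (Hor d → ℝ)) (I : Set ℝ)
    (u : ℝ → Amb d → Amb d) (p : ℝ → Amb d → ℝ) (η : ℝ → Hor d → ℝ) : Prop :=
  ∀ t ∈ I,
    IsDarcyFlow .lower b (η t) μ ρ (u t) (p t) ∧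
    HasTrace .lower b (η t) (p t) 0 ∧
    HasTimeDeriv I η t (normalTrace .lower b (η t) (u t))

/-- `(u^±, p^±, η)` solves the two-phase Muskat problem on the time interval `I`: at each time,
Darcy flows on both sides of the interface, with continuous normal velocity and pressure across
it, and the interface moves with the fluid. -/
def SolvesTwoPhase (μp μm ρp ρm : ℝ) (bp bm : Option (Hor d → ℝ)) (I : Set ℝ)
    (up um : ℝ → Amb d → Amb d) (pp pm : ℝ → Amb d → ℝ) (η : ℝ → Hor d → ℝ) : Prop :=
  ∀ t ∈ I,
    IsDarcyFlow .upper bp (η t) μp ρp (up t) (pp t) ∧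
    IsDarcyFlow .lower bm (η t) μm ρm (um t) (pm t) ∧
    normalTrace .upper bp (η t) (up t) = normalTrace .lower bm (η t) (um t) ∧
    (∃ g, HasTrace .upper bp (η t) (pp t) g ∧ HasTrace .lower bm (η t) (pm t) g) ∧
    HasTimeDeriv I η t (normalTrace .lower bm (η t) (um t))

/-- `∂_t η + κ G⁻(η) η = 0` on the time interval `I`. -/
def SolvesOnePhaseEq (κ : ℝ) (b : Option (Hor d → ℝ)) (I : Set ℝ) (η : ℝ → Hor d → ℝ) : Prop :=
  ∀ t ∈ I, InDomain .lower b (η t) (η t) ∧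
    ∃ v, HasTimeDeriv I η t v ∧ v + κ • dirichletNeumann .lower b (η t) (η t) = 0

/-- `∂_t η = -(1/μ⁻) G⁻(η) f⁻` on the time interval `I`, where at each time `f^±` satisfy
`f⁺ - f⁻ = (ρ⁺ - ρ⁻) η` and `(1/μ⁺) G⁺(η) f⁺ - (1/μ⁻) G⁻(η) f⁻ = 0`. -/
def SolvesTwoPhaseEq (μp μm ρp ρm : ℝ) (bp bm : Option (Hor d → ℝ)) (I : Set ℝ)
    (η fp fm : ℝ → Hor d → ℝ) : Prop :=
  ∀ t ∈ I, InDomain .upper bp (η t) (fp t) ∧ InDomain .lower bm (η t) (fm t) ∧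
    HasTimeDeriv I η t (-((1 / μm) • dirichletNeumann .lower bm (η t) (fm t))) ∧
    (∀ᵐ x, fp t x - fm t x = (ρp - ρm) * η t x) ∧
    (1 / μp) • dirichletNeumann .upper bp (η t) (fp t) -
      (1 / μm) • dirichletNeumann .lower bm (η t) (fm t) = 0

end Muskat

end

noncomputable section

namespace Muskat

variable {d : ℕ}

/-! Put φ = p + ρy. Darcy's law says ∇φ = -μu, so u ∈ L² gives φ finite energy, and the weak
impermeability condition becomes the weak mixed problem for φ with trace f = p|Σ + ρη. Hence the
normal trace of u is -(1/μ) G f. Conversely, the variational solution φ with trace f yields a Darcy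
flow u = -(1/μ)∇φ, p = φ - ρy. Both statements are this dictionary at each fixed time
(`IsDarcyFlow.exists_isDirichletSolution`, `IsDirichletSolution.isDarcyFlow`,
`IsDirichletSolution.normalTrace_eq`). In one phase p = 0 on Σ means f = ρη, and homogeneity of G
gives (1); in two phases continuity of pressure and of normal velocity are the two equations (3).

Two analytic facts are needed. First, impermeability is tested only with w of bounded support, the
variational problem with every finite-energy w of zero trace. Truncating w by a cutoff at scale R
leaves an error of size R⁻¹ ‖w‖ ‖u‖, with w measured on a ball of radius 3R and u off the ball of
radius R. Since ‖w‖ grows at most like R, the error is controlled by the tail of u and tends to 0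
(`IsImpermeable.integral_dot_eq_zero`). Second, the variational solution must exist and be unique up
to its gradient a.e., so that the chosen `potentialGradient` is the right one. Existence is an
orthogonal projection in L², provided the gradients of zero-trace functions form a closed subspace.

Both rest on one representation: a function w with zero trace is the vertical primitive, starting at
the interface, of ∂_y w (`HasTrace.ae_eq_vertInt`). By Cauchy–Schwarz and the Lipschitz bound on η
this gives the linear growth of ‖w‖. It also shows that an L² field W is such a gradient exactly
when the primitive of its vertical component has weak gradient W. Fubini (`integral_vertInt_mul`)
rewrites this condition as orthogonality to explicit L² fields (`compatField`), and an orthogonal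
complement is closed. -/

/-- `dot` as a continuous bilinear form. -/
def dotL : Amb d →L[ℝ] Amb d →L[ℝ] ℝ :=
  ((isBoundedBilinearMap_inner (𝕜 := ℝ) (E := Hor d)).toContinuousLinearMap).bilinearComp (ContinuousLinearMap.fst ℝ (Hor d) ℝ)
      (ContinuousLinearMap.fst ℝ (Hor d) ℝ) +
    (ContinuousLinearMap.mul ℝ ℝ).bilinearComp (ContinuousLinearMap.snd ℝ (Hor d) ℝ)
      (ContinuousLinearMap.snd ℝ (Hor d) ℝ)

@[simp] theorem dotL_apply (v w : Amb d) : dotL v w = dot v w := rfl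

theorem dot_comm (v w : Amb d) : dot v w = dot w v := by
  simp only [dot, real_inner_comm, mul_comm]

theorem dot_add_left (u v w : Amb d) : dot (u + v) w = dot u w + dot v w := by
  simp only [← dotL_apply, map_add, add_apply]

theorem dot_sub_left (u v w : Amb d) : dot (u - v) w = dot u w - dot v w := by
  simp only [← dotL_apply, map_sub, sub_apply]

theorem dot_smul_left (c : ℝ) (v w : Amb d) : dot (c • v) w = c * dot v w := by
  simp only [← dotL_apply, map_smul, smul_apply, smul_eq_mul]

theorem dot_add_right (u v w : Amb d) : dot u (v + w) = dot u v + dot u w := by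
  simp only [← dotL_apply, map_add]

theorem dot_smul_right (c : ℝ) (v w : Amb d) : dot v (c • w) = c * dot v w := by
  simp only [← dotL_apply, map_smul, smul_eq_mul]

@[simp] theorem dot_vertical_right (v : Amb d) (r : ℝ) : dot v ((0 : Hor d), r) = v.2 * r := by
  simp [dot]

theorem dot_self_nonneg (v : Amb d) : 0 ≤ dot v v :=
  add_nonneg real_inner_self_nonneg (mul_self_nonneg _)

theorem dot_self_eq_zero {v : Amb d} (h : dot v v = 0) : v = 0 := by
  have h1 : (0 : ℝ) ≤ inner ℝ v.1 v.1 := real_inner_self_nonneg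
  have h2 := mul_self_nonneg v.2
  unfold dot at h
  ext1
  · exact inner_self_eq_zero.1 (by linarith : inner ℝ v.1 v.1 = 0)
  · exact mul_self_eq_zero.1 (by linarith)

/-- The vector representing a linear form with respect to `dot`. -/
def riesz (L : Amb d →L[ℝ] ℝ) : Amb d :=
  ((InnerProductSpace.toDual ℝ (Hor d)).symm (L.comp (ContinuousLinearMap.inl ℝ (Hor d) ℝ)),
    L (0, 1))

theorem dot_riesz_left (L : Amb d →L[ℝ] ℝ) (v : Amb d) : dot (riesz L) v = L v := by
  obtain ⟨x, y⟩ := v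
  have h : L (x, y) = L (x, 0) + y • L (0, 1) := by
    rw [← map_smul, ← map_add]; simp
  simp [dot, riesz, h, mul_comm]

theorem dot_riesz_right (L : Amb d →L[ℝ] ℝ) (v : Amb d) : dot v (riesz L) = L v := by
  rw [dot_comm, dot_riesz_left]

@[simp] theorem riesz_snd (L : Amb d →L[ℝ] ℝ) : (riesz L).2 = L (0, 1) := rfl

theorem continuous_riesz : Continuous (riesz : (Amb d →L[ℝ] ℝ) → Amb d) := by
  unfold riesz
  refine Continuous.prodMk ?_ (by fun_prop)
  exact (InnerProductSpace.toDual ℝ (Hor d)).symm.continuous.comp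
    (by fun_prop)

@[simp] theorem riesz_zero : riesz (0 : Amb d →L[ℝ] ℝ) = 0 := by
  ext1 <;> simp [riesz]

/-- The gradient of a differentiable function with respect to `dot`. -/
def grad (Φ : Amb d → ℝ) (z : Amb d) : Amb d := riesz (fderiv ℝ Φ z)

/-! ### Test functions -/

section Test

variable {X : Type*} [NormedAddCommGroup X] [NormedSpace ℝ X] {Φ Ψ : X → ℝ}

theorem IsTest.differentiable (h : IsTest Φ) : Differentiable ℝ Φ :=
  h.1.differentiable (by simp)

theorem IsTest.continuous (h : IsTest Φ) : Continuous Φ := h.1.continuous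

theorem IsTest.continuous_fderiv (h : IsTest Φ) : Continuous (fderiv ℝ Φ) :=
  h.1.continuous_fderiv (by simp)

theorem IsTest.fderiv_apply (h : IsTest Φ) (v : X) : IsTest fun z => fderiv ℝ Φ z v :=
  ⟨(h.1.fderiv_right (m := ∞) (by simp)).clm_apply contDiff_const, h.2.fderiv_apply (𝕜 := ℝ) v⟩

theorem tsupport_fderiv_apply_subset' (Φ : X → ℝ) (v : X) :
    tsupport (fun z => fderiv ℝ Φ z v) ⊆ tsupport Φ :=
  tsupport_fderiv_apply_subset ℝ v

theorem IsTest.mul_left (h : IsTest Φ) (hΨ : ContDiff ℝ ∞ Ψ) : IsTest fun z => Ψ z * Φ z :=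
  ⟨hΨ.mul h.1, h.2.mul_left⟩

theorem fderiv_mul_apply' (hΨ : Differentiable ℝ Ψ) (hΦ : Differentiable ℝ Φ) (z v : X) :
    fderiv ℝ (fun z => Ψ z * Φ z) z v = Ψ z * fderiv ℝ Φ z v + fderiv ℝ Ψ z v * Φ z := by
  rw [fderiv_fun_mul hΨ.differentiableAt hΦ.differentiableAt]
  simp [mul_comm]

end Test

theorem IsTest.continuous_grad {Φ : Amb d → ℝ} (h : IsTest Φ) : Continuous (grad Φ) :=
  continuous_riesz.comp h.continuous_fderiv

theorem IsTest.hasCompactSupport_grad {Φ : Amb d → ℝ} (h : IsTest Φ) :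
    HasCompactSupport (grad Φ) :=
  (h.2.fderiv (𝕜 := ℝ)).comp_left (g := riesz) riesz_zero

/-! ### The fluid domain -/

theorem isOpen_domain {s : Phase} {b : Option (Hor d → ℝ)} {η : Hor d → ℝ}
    (h : Admissible s b η) : IsOpen (s.domain b η) := by
  obtain ⟨K, hη⟩ := h.lipschitz_interface
  have hη := hη.continuous
  have h1 : IsOpen {z : Amb d | 0 < s.sign * (z.2 - η z.1)} :=
    isOpen_lt continuous_const (by fun_prop)
  rcases b with _ | b₀
  · simpa [Phase.domain] using h1
  · obtain ⟨L, hb⟩ := h.lipschitz_wall b₀ rfl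
    have hb := hb.continuous
    have h2 : IsOpen {z : Amb d | 0 < s.sign * (b₀ z.1 - z.2)} :=
      isOpen_lt continuous_const (by fun_prop)
    simpa [Phase.domain, ofPred_and] using h1.inter h2

theorem Admissible.continuous {s : Phase} {b : Option (Hor d → ℝ)} {η : Hor d → ℝ}
    (h : Admissible s b η) : Continuous η :=
  h.lipschitz_interface.choose_spec.continuous

/-! ### Local square integrability -/

/-- Square integrability on bounded subsets of `Ω`. -/
def LocL2 {X : Type*} [NormedAddCommGroup X] (Ω : Set (Amb d)) (φ : Amb d → X) : Prop :=
  ∀ R : ℝ, MemLp φ 2 (volume.restrict (Ω ∩ Metric.ball 0 R))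

theorem memLp_of_inter_ball {X : Type*} [NormedAddCommGroup X] {Ω : Set (Amb d)}
    (hΩ : MeasurableSet Ω) {f : Amb d → X} {R : ℝ}
    (h : MemLp f 2 (volume.restrict (Ω ∩ Metric.ball 0 R)))
    (h0 : ∀ z ∈ Ω, z ∉ Metric.ball (0 : Amb d) R → f z = 0) :
    MemLp f 2 (volume.restrict Ω) := by
  rw [← memLp_indicator_iff_restrict (hΩ.inter Metric.isOpen_ball.measurableSet)] at h
  rw [← memLp_indicator_iff_restrict hΩ]
  convert h using 1
  ext z
  by_cases hz : z ∈ Ω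
  · by_cases hz' : z ∈ Metric.ball (0 : Amb d) R
    · simp [hz, hz', indicator]
    · simp [indicator, hz', h0 z hz hz']
  · simp [hz]

section LocL2

variable {X Y Z : Type*} [NormedAddCommGroup X] [NormedAddCommGroup Y] [NormedAddCommGroup Z]
  {Ω : Set (Amb d)} {φ ψ : Amb d → X}

theorem _root_.MeasureTheory.MemLp.locL2 (h : MemLp φ 2 (volume.restrict Ω)) : LocL2 Ω φ :=
  fun _ => h.mono_measure (Measure.restrict_mono inter_subset_left le_rfl)

theorem _root_.Continuous.locL2 (h : Continuous φ) (Ω : Set (Amb d)) : LocL2 Ω φ := by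
  intro R
  have hK := isCompact_closedBall (0 : Amb d) R
  obtain ⟨C, hC⟩ := hK.exists_bound_of_continuousOn h.continuousOn
  have : IsFiniteMeasure (volume.restrict (Metric.closedBall (0 : Amb d) R)) :=
    ⟨by simpa using hK.measure_lt_top⟩
  refine MemLp.mono_measure (Measure.restrict_mono
    (inter_subset_right.trans Metric.ball_subset_closedBall) le_rfl) ?_
  exact MemLp.of_bound h.aestronglyMeasurable C
    (ae_restrict_of_forall_mem Metric.isClosed_closedBall.measurableSet hC)

theorem LocL2.add (h : LocL2 Ω φ) (h' : LocL2 Ω ψ) : LocL2 Ω (fun z => φ z + ψ z) :=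
  fun R => (h R).add (h' R)

theorem LocL2.const_smul [NormedSpace ℝ X] (h : LocL2 Ω φ) (c : ℝ) :
    LocL2 Ω (fun z => c • φ z) :=
  fun R => (h R).const_smul c

theorem LocL2.clm_comp [NormedSpace ℝ X] [NormedSpace ℝ Y] (h : LocL2 Ω φ) (L : X →L[ℝ] Y) :
    LocL2 Ω (fun z => L (φ z)) :=
  fun R => L.comp_memLp' (h R)


theorem LocL2.locallyIntegrableOn (hΩ : IsOpen Ω) (h : LocL2 Ω φ) :
    LocallyIntegrableOn φ Ω := by
  rw [locallyIntegrableOn_iff hΩ.isLocallyClosed]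
  intro K hK hKc
  obtain ⟨R, hR⟩ := hKc.isBounded.subset_ball (0 : Amb d)
  have : IsFiniteMeasure (volume.restrict (Ω ∩ Metric.ball (0 : Amb d) R)) :=
    ⟨by simpa using (measure_mono inter_subset_right).trans_lt measure_ball_lt_top⟩
  exact IntegrableOn.mono_set ((h R).integrable one_le_two) (subset_inter hK hR)

variable [NormedSpace ℝ X] [NormedSpace ℝ Y] [NormedSpace ℝ Z]

theorem _root_.MeasureTheory.MemLp.integrable_bilin {α : Type*} [MeasurableSpace α]
    {μ : Measure α} {f : α → X} {g : α → Y} (hf : MemLp f 2 μ) (hg : MemLp g 2 μ)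
    (B : X →L[ℝ] Y →L[ℝ] Z) : Integrable (fun a => B (f a) (g a)) μ := by
  rw [← memLp_one_iff_integrable]
  refine MemLp.of_bilin (p := 2) (q := 2) (fun a b => B a b) ‖B‖₊ hf hg ?_ ?_
  · exact B.aestronglyMeasurable_comp₂ hf.1 hg.1
  · exact Filter.Eventually.of_forall fun a => B.le_opNorm₂ _ _

theorem LocL2.memLp_bilin (h : LocL2 Ω φ) (B : X →L[ℝ] Y →L[ℝ] Z) {g : Amb d → Y}
    (hg : Continuous g) (R : ℝ) :
    MemLp (fun z => B (φ z) (g z)) 2 (volume.restrict (Ω ∩ Metric.ball 0 R)) := by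
  have hK := isCompact_closedBall (0 : Amb d) R
  obtain ⟨C, hC⟩ := hK.exists_bound_of_continuousOn hg.continuousOn
  have h0 : ∀ᵐ z ∂(volume.restrict (Ω ∩ Metric.ball (0 : Amb d) R)), ‖g z‖ ≤ C := by
    refine ae_mono (Measure.restrict_mono
      (inter_subset_right.trans Metric.ball_subset_closedBall) le_rfl)
      (ae_restrict_of_forall_mem Metric.isClosed_closedBall.measurableSet hC)
  refine MemLp.of_le_mul (c := ‖B‖ * C) (h R)
    (B.aestronglyMeasurable_comp₂ (h R).1 hg.aestronglyMeasurable) ?_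
  filter_upwards [h0] with z hz
  calc ‖B (φ z) (g z)‖ ≤ ‖B‖ * ‖φ z‖ * ‖g z‖ := B.le_opNorm₂ _ _
    _ ≤ ‖B‖ * ‖φ z‖ * C := by gcongr
    _ = _ := by ring

theorem LocL2.memLp_bilin_of_hasCompactSupport (hΩ : MeasurableSet Ω) (h : LocL2 Ω φ)
    (B : X →L[ℝ] Y →L[ℝ] Z)
    {g : Amb d → Y} (hg : Continuous g) (hgc : HasCompactSupport g) :
    MemLp (fun z => B (φ z) (g z)) 2 (volume.restrict Ω) := by
  obtain ⟨R, hR⟩ := hgc.isBounded.subset_ball (0 : Amb d)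
  refine memLp_of_inter_ball hΩ (h.memLp_bilin B hg R) fun z _ hz => ?_
  have : g z = 0 := by
    by_contra h0
    exact hz (hR (subset_tsupport _ h0))
  simp [this]

theorem LocL2.integrable_bilin (hΩ : MeasurableSet Ω) (h : LocL2 Ω φ)
    (B : X →L[ℝ] Y →L[ℝ] Z)
    {g : Amb d → Y} (hg : Continuous g) (hgc : HasCompactSupport g) :
    IntegrableOn (fun z => B (φ z) (g z)) Ω := by
  obtain ⟨R, hR⟩ := hgc.isBounded.subset_ball (0 : Amb d)
  have h1 : IntegrableOn (fun z => B (φ z) (g z)) (Ω ∩ Metric.ball (0 : Amb d) R) :=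
    (h R).integrable_bilin (hg.locL2 Ω R) B
  refine h1.of_forall_sdiff_eq_zero hΩ ?_
  rintro z ⟨hz, hz'⟩
  have : g z = 0 := by
    by_contra h0
    exact hz' ⟨hz, hR (subset_tsupport _ h0)⟩
  simp [this]

theorem LocL2.integrable_mul {φ : Amb d → ℝ} (hΩ : MeasurableSet Ω) (h : LocL2 Ω φ)
    {g : Amb d → ℝ} (hg : Continuous g) (hgc : HasCompactSupport g) :
    IntegrableOn (fun z => φ z * g z) Ω :=
  h.integrable_bilin hΩ (ContinuousLinearMap.mul ℝ ℝ) hg hgc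

theorem LocL2.integrable_dot_mul {F : Amb d → Amb d} (hΩ : MeasurableSet Ω) (h : LocL2 Ω F)
    (v : Amb d) {g : Amb d → ℝ} (hg : Continuous g) (hgc : HasCompactSupport g) :
    IntegrableOn (fun z => dot (F z) v * g z) Ω :=
  LocL2.integrable_mul (φ := fun z => dotL.flip v (F z)) hΩ (h.clm_comp (dotL.flip v)) hg hgc

theorem LocL2.snd {F : Amb d → Amb d} (h : LocL2 Ω F) : LocL2 Ω fun z => (F z).2 :=
  h.clm_comp (ContinuousLinearMap.snd ℝ (Hor d) ℝ)

end LocL2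

/-! ### Weak gradients and traces: linearity and uniqueness -/

section Sobolev

variable {s : Phase} {b : Option (Hor d → ℝ)} {η : Hor d → ℝ} {Ω : Set (Amb d)}
  {φ φ' : Amb d → ℝ} {F F' : Amb d → Amb d} {f f' : Hor d → ℝ}

theorem IsH1Loc.linear_combination (hΩ : MeasurableSet Ω) (h : IsH1Loc Ω φ F)
    (h' : IsH1Loc Ω φ' F') (a c : ℝ) :
    IsH1Loc Ω (fun z => a * φ z + c * φ' z) (fun z => a • F z + c • F' z) where
  memLp R := ((h.memLp R).const_mul a).add ((h'.memLp R).const_mul c)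
  memLp_grad R := ((h.memLp_grad R).const_smul a).add ((h'.memLp_grad R).const_smul c)
  weakGradient := by
    intro Φ hΦ hs v
    have hv := hΦ.fderiv_apply v
    have i1 := LocL2.integrable_mul hΩ h.memLp hv.continuous hv.2
    have i2 := LocL2.integrable_mul hΩ h'.memLp hv.continuous hv.2
    have j1 := LocL2.integrable_dot_mul hΩ h.memLp_grad v hΦ.continuous hΦ.2
    have j2 := LocL2.integrable_dot_mul hΩ h'.memLp_grad v hΦ.continuous hΦ.2
    have e1 : ∀ z, (a * φ z + c * φ' z) * fderiv ℝ Φ z v =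
      a * (φ z * fderiv ℝ Φ z v) + c * (φ' z * fderiv ℝ Φ z v) := fun z => by ring
    have e2 : ∀ z, dot (a • F z + c • F' z) v * Φ z =
      a * (dot (F z) v * Φ z) + c * (dot (F' z) v * Φ z) := fun z => by
        rw [dot_add_left, dot_smul_left, dot_smul_left]; ring
    simp only [e1, e2]
    rw [integral_add (i1.const_mul a) (i2.const_mul c),
      integral_add (j1.const_mul a) (j2.const_mul c)]
    simp only [integral_const_mul]
    rw [h.weakGradient Φ hΦ hs v, h'.weakGradient Φ hΦ hs v]
    ring

theorem IsFiniteEnergy.linear_combination (hΩ : MeasurableSet Ω) (h : IsFiniteEnergy Ω φ F)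
    (h' : IsFiniteEnergy Ω φ' F') (a c : ℝ) :
    IsFiniteEnergy Ω (fun z => a * φ z + c * φ' z) (fun z => a • F z + c • F' z) where
  isH1Loc := h.isH1Loc.linear_combination hΩ h'.isH1Loc a c
  memLp_grad := (h.memLp_grad.const_smul a).add (h'.memLp_grad.const_smul c)

theorem IsH1Loc.integrable_green (hΩ : MeasurableSet Ω) (h : IsH1Loc Ω φ F)
    {Φ : Amb d → ℝ} (hΦ : IsTest Φ) :
    IntegrableOn (fun z => (F z).2 * Φ z + φ z * fderiv ℝ Φ z (0, 1)) Ω :=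
  (LocL2.integrable_mul hΩ (LocL2.snd h.memLp_grad) hΦ.continuous hΦ.2).add
    (LocL2.integrable_mul hΩ h.memLp (hΦ.fderiv_apply _).continuous (hΦ.fderiv_apply _).2)

theorem integrable_comp_graph (hη : Continuous η) (hf : LocallyIntegrable f volume)
    {Φ : Amb d → ℝ} (hΦ : Continuous Φ) (hc : HasCompactSupport Φ) :
    Integrable fun x => f x * Φ (x, η x) := by
  have hg : Continuous fun x : Hor d => Φ (x, η x) := by fun_prop
  have hK : IsCompact (Prod.fst '' tsupport Φ) := hc.isCompact.image continuous_fst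
  have hgc : HasCompactSupport fun x : Hor d => Φ (x, η x) := by
    refine HasCompactSupport.intro hK fun x hx => ?_
    by_contra h0
    exact hx ⟨(x, η x), subset_tsupport _ h0, rfl⟩
  simpa [mul_comm] using hf.integrable_smul_left_of_hasCompactSupport hg hgc

theorem HasTrace.linear_combination (ha : Admissible s b η) (h : HasTrace s b η φ f)
    (h' : HasTrace s b η φ' f') (a c : ℝ) :
    HasTrace s b η (fun z => a * φ z + c * φ' z) (fun x => a * f x + c * f' x) := by
  obtain ⟨hf, F, hF, hF'⟩ := h
  obtain ⟨hg, G, hG, hG'⟩ := h'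
  have hΩ := (isOpen_domain ha).measurableSet
  refine ⟨(hf.smul a).add (hg.smul c), _, hF.linear_combination hΩ hG a c, fun Φ hΦ hd => ?_⟩
  have e1 : ∀ z, (a • F z + c • G z).2 * Φ z + (a * φ z + c * φ' z) * fderiv ℝ Φ z (0, 1) =
      a * ((F z).2 * Φ z + φ z * fderiv ℝ Φ z (0, 1)) +
        c * ((G z).2 * Φ z + φ' z * fderiv ℝ Φ z (0, 1)) := fun z => by
    simp only [Prod.snd_add, Prod.smul_snd, smul_eq_mul]; ring
  have e2 : ∀ x, (a * f x + c * f' x) * Φ (x, η x) =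
    a * (f x * Φ (x, η x)) + c * (f' x * Φ (x, η x)) := fun x => by ring
  simp only [e1, e2]
  rw [integral_add ((hF.integrable_green hΩ hΦ).const_mul a)
      ((hG.integrable_green hΩ hΦ).const_mul c),
    integral_add ((integrable_comp_graph ha.continuous hf hΦ.continuous hΦ.2).const_mul a)
      ((integrable_comp_graph ha.continuous hg hΦ.continuous hΦ.2).const_mul c)]
  simp only [integral_const_mul]
  rw [hF' Φ hΦ hd, hG' Φ hΦ hd]
  ring

/-- The scalar fundamental lemma is reached by testing in one direction only: v is taken to be the
integral of g (F - F') itself, and the two weak-gradient identities then give v · v = 0. -/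
theorem HasWeakGradient.unique (hΩ : IsOpen Ω) (h : HasWeakGradient Ω φ F)
    (h' : HasWeakGradient Ω φ F') (hF : LocL2 Ω F) (hF' : LocL2 Ω F') :
    ∀ᵐ z ∂(volume.restrict Ω), F z = F' z := by
  have hm := hΩ.measurableSet
  have hL : LocL2 Ω (fun z => F z - F' z) := by
    simpa [sub_eq_add_neg] using hF.add (hF'.const_smul (-1))
  rw [ae_restrict_iff' hm]
  have key := hΩ.ae_eq_zero_of_integral_contDiff_smul_eq_zero (hL.locallyIntegrableOn hΩ)
    (fun g hg hgc hgs => ?_)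
  · filter_upwards [key] with z hz hzΩ
    exact sub_eq_zero.1 (hz hzΩ)
  have hgt : IsTest g := ⟨hg, hgc⟩
  have hint : IntegrableOn (fun z => g z • (F z - F' z)) Ω :=
    (hL.integrable_bilin hm (ContinuousLinearMap.lsmul ℝ ℝ).flip hgt.continuous hgc)
  have hzero : ∀ z, z ∉ Ω → g z • (F z - F' z) = 0 := by
    intro z hz
    have : g z = 0 := by
      by_contra h0
      exact hz (hgs (subset_tsupport _ h0))
    simp [this]
  rw [← setIntegral_eq_integral_of_forall_compl_eq_zero hzero]
  refine dot_self_eq_zero ?_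
  set v := ∫ z in Ω, g z • (F z - F' z) with hv
  have : dot v v = ∫ z in Ω, dot (g z • (F z - F' z)) v := by
    conv_lhs => rw [← dotL_apply, ← ContinuousLinearMap.flip_apply, hv,
      ← ContinuousLinearMap.integral_comp_comm _ hint]
    rfl
  rw [this]
  have e : ∀ z, dot (g z • (F z - F' z)) v = dot (F z) v * g z - dot (F' z) v * g z := fun z => by
    rw [dot_smul_left, dot_sub_left]; ring
  simp only [e]
  rw [integral_sub (hF.integrable_dot_mul hm v hgt.continuous hgc)
    (hF'.integrable_dot_mul hm v hgt.continuous hgc)]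
  have h1 := h g hgt hgs v
  have h2 := h' g hgt hgs v
  linarith

/-- Green's formula of `HasTrace` holds with any weak gradient. -/
theorem HasTrace.green (ha : Admissible s b η) (h : HasTrace s b η φ f)
    (hF : IsH1Loc (s.domain b η) φ F) {Φ : Amb d → ℝ} (hΦ : IsTest Φ)
    (hd : Disjoint (tsupport Φ) (wall b)) :
    ∫ z in s.domain b η, ((F z).2 * Φ z + φ z * fderiv ℝ Φ z (0, 1)) =
        -s.sign * ∫ x, f x * Φ (x, η x) := by
  obtain ⟨hf, G, hG, hG'⟩ := h
  rw [← hG' Φ hΦ hd]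
  refine integral_congr_ae ?_
  filter_upwards [hG.weakGradient.unique (isOpen_domain ha) hF.weakGradient hG.memLp_grad
    hF.memLp_grad] with z hz
  rw [hz]

theorem Phase.sign_mul_self (s : Phase) : s.sign * s.sign = 1 := by
  cases s <;> simp [Phase.sign]

theorem Phase.sign_ne_zero (s : Phase) : s.sign ≠ 0 := by
  cases s <;> simp [Phase.sign]

/-- Every test function of x is the restriction to the interface of an admissible Φ, so Green's
formula determines the integrals of f against all test functions. -/
theorem HasTrace.unique (ha : Admissible s b η) (h : HasTrace s b η φ f)
    (h' : HasTrace s b η φ f') : ∀ᵐ x, f x = f' x := by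
  refine ae_eq_of_integral_contDiff_smul_eq h.1 h'.1 fun g hg hgc => ?_
  obtain ⟨Ψ, hΨ, hd, hΨg⟩ := exists_isExtension ha ⟨g, hg, hgc⟩
  have h1 := h.green ha h.2.choose_spec.1 hΨ hd
  have h2 := h'.green ha h.2.choose_spec.1 hΨ hd
  rw [h1] at h2
  have := mul_left_cancel₀ (neg_ne_zero.2 s.sign_ne_zero) h2
  simpa only [hΨg, smul_eq_mul, mul_comm] using this

theorem HasTrace.congr_ae (h : HasTrace s b η φ f) (hf : ∀ᵐ x, f x = f' x) :
    HasTrace s b η φ f' := by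
  obtain ⟨h0, F, hF, hG⟩ := h
  refine ⟨h0.congr hf, F, hF, fun Φ hΦ hd => ?_⟩
  rw [hG Φ hΦ hd]
  congr 1
  refine integral_congr_ae ?_
  filter_upwards [hf] with x hx
  rw [hx]

/-! ### Smooth functions -/

instance : (volume : Measure (Amb d)).IsAddHaarMeasure :=
  inferInstanceAs ((volume : Measure (Hor d)).prod (volume : Measure ℝ)).IsAddHaarMeasure

/-- Integration by parts on the whole space against the constant 1. -/
theorem setIntegral_fderiv_eq_zero {Φ : Amb d → ℝ} (hΦ : IsTest Φ) (hs : tsupport Φ ⊆ Ω)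
    (v : Amb d) : ∫ z in Ω, fderiv ℝ Φ z v = 0 := by
  rw [setIntegral_eq_integral_of_forall_compl_eq_zero]
  · have i1 : Integrable (fun z => fderiv ℝ Φ z v) :=
      (hΦ.fderiv_apply v).continuous.integrable_of_hasCompactSupport (hΦ.fderiv_apply v).2
    have i2 : Integrable Φ := hΦ.continuous.integrable_of_hasCompactSupport hΦ.2
    have := integral_mul_fderiv_eq_neg_fderiv_mul_of_integrable (μ := (volume : Measure (Amb d)))
      (f := fun _ => (1 : ℝ)) (g := Φ) (v := v) (by simp)
      (by simpa using i1) (by simpa using i2)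
      (fun _ _ => by fun_prop) (fun z _ => hΦ.differentiable z)
    simpa using this
  · intro z hz
    by_contra h0
    exact hz (hs (tsupport_fderiv_apply_subset' Φ v (subset_tsupport _ h0)))

theorem isH1Loc_of_contDiff (hΩ : MeasurableSet Ω) {Ψ : Amb d → ℝ} (hΨ : ContDiff ℝ ∞ Ψ) :
    IsH1Loc Ω Ψ (grad Ψ) where
  memLp := hΨ.continuous.locL2 Ω
  memLp_grad := (continuous_riesz.comp (hΨ.continuous_fderiv (by simp))).locL2 Ω
  weakGradient := by
    intro Φ hΦ hs v
    have hd : Differentiable ℝ Ψ := hΨ.differentiable (by simp)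
    have hv := hΦ.fderiv_apply v
    have hts : tsupport (fun z => Ψ z * Φ z) ⊆ Ω :=
      (closure_mono (Function.support_mul_subset_right Ψ Φ)).trans hs
    have := setIntegral_fderiv_eq_zero (hΦ.mul_left hΨ) hts v
    simp only [fderiv_mul_apply' hd hΦ.differentiable] at this
    rw [integral_add] at this
    · simp only [grad, dot_riesz_left]
      linarith
    · exact (hΨ.continuous.locL2 Ω).integrable_mul hΩ hv.continuous hv.2
    · exact LocL2.integrable_mul hΩ (φ := fun z => fderiv ℝ Ψ z v)
        (Continuous.locL2 ((hΨ.continuous_fderiv (by simp)).clm_apply continuous_const) Ω)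
        hΦ.continuous hΦ.2

theorem IsTest.isFiniteEnergy (hΩ : MeasurableSet Ω) {Φ : Amb d → ℝ} (hΦ : IsTest Φ) :
    IsFiniteEnergy Ω Φ (grad Φ) where
  isH1Loc := isH1Loc_of_contDiff hΩ hΦ.1
  memLp_grad := (hΦ.continuous_grad.memLp_of_hasCompactSupport hΦ.hasCompactSupport_grad).restrict Ω

/-- Makes test functions supported in the fluid admissible in the variational formulation, which is
how div u = 0 is recovered from it. -/
theorem IsTest.hasTrace_zero (hΩ : MeasurableSet (s.domain b η)) {Φ : Amb d → ℝ} (hΦ : IsTest Φ)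
    (hs : tsupport Φ ⊆ s.domain b η) : HasTrace s b η Φ 0 := by
  refine ⟨locallyIntegrable_zero, grad Φ, isH1Loc_of_contDiff hΩ hΦ.1, fun Ψ hΨ _ => ?_⟩
  have hts : tsupport (fun z => Ψ z * Φ z) ⊆ s.domain b η :=
    (closure_mono (Function.support_mul_subset_right Ψ Φ)).trans hs
  have := setIntegral_fderiv_eq_zero (hΦ.mul_left hΨ.1) hts (0, 1)
  simp only [fderiv_mul_apply' hΨ.differentiable hΦ.differentiable] at this
  simp only [Pi.zero_apply, zero_mul, integral_zero, mul_zero]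
  rw [← this]
  congr 1
  ext z
  simp only [grad, riesz_snd]
  ring

/-! ### Multiplication by a cutoff -/

/-- The weak product rule follows by using χΦ as the test function for φ. -/
theorem IsH1Loc.mul_contDiff (hΩ : MeasurableSet Ω) (h : IsH1Loc Ω φ F)
    {χ : Amb d → ℝ} (hχ : ContDiff ℝ ∞ χ) :
    IsH1Loc Ω (fun z => χ z * φ z) (fun z => χ z • F z + φ z • grad χ z) where
  memLp R := LocL2.memLp_bilin h.memLp (ContinuousLinearMap.mul ℝ ℝ).flip hχ.continuous R
  memLp_grad R :=
    (LocL2.memLp_bilin h.memLp_grad (ContinuousLinearMap.lsmul ℝ ℝ).flip hχ.continuous R).add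
    (LocL2.memLp_bilin h.memLp (ContinuousLinearMap.lsmul ℝ ℝ)
      (continuous_riesz.comp (hχ.continuous_fderiv (by simp))) R)
  weakGradient := by
    intro Φ hΦ hs v
    have hd : Differentiable ℝ χ := hχ.differentiable (by simp)
    have hχ' : Continuous fun z => fderiv ℝ χ z v :=
      (hχ.continuous_fderiv (by simp)).clm_apply continuous_const
    have hts : tsupport (fun z => χ z * Φ z) ⊆ Ω :=
      (closure_mono (Function.support_mul_subset_right χ Φ)).trans hs
    have hχΦ := hΦ.mul_left hχ
    have key := h.weakGradient _ hχΦ hts v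
    have i1 : IntegrableOn (fun z => φ z * fderiv ℝ (fun z => χ z * Φ z) z v) Ω :=
      LocL2.integrable_mul hΩ h.memLp (hχΦ.fderiv_apply v).continuous (hχΦ.fderiv_apply v).2
    have i2 : IntegrableOn (fun z => φ z * (fderiv ℝ χ z v * Φ z)) Ω :=
      LocL2.integrable_mul hΩ h.memLp (hχ'.mul hΦ.continuous) hΦ.2.mul_left
    have i3 : IntegrableOn (fun z => dot (F z) v * (χ z * Φ z)) Ω :=
      LocL2.integrable_dot_mul hΩ h.memLp_grad v hχΦ.continuous hχΦ.2
    have e1 : ∀ z, χ z * φ z * fderiv ℝ Φ z v =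
        φ z * fderiv ℝ (fun z => χ z * Φ z) z v - φ z * (fderiv ℝ χ z v * Φ z) := fun z => by
      rw [fderiv_mul_apply' hd hΦ.differentiable]; ring
    have e2 : ∀ z, dot (χ z • F z + φ z • grad χ z) v * Φ z =
        dot (F z) v * (χ z * Φ z) + φ z * (fderiv ℝ χ z v * Φ z) := fun z => by
      rw [dot_add_left, dot_smul_left, dot_smul_left, grad, dot_riesz_left]; ring
    simp only [e1, e2]
    rw [integral_sub i1 i2, integral_add i3 i2, key]
    ring

theorem IsFiniteEnergy.mul_isTest (hΩ : MeasurableSet Ω) (h : IsFiniteEnergy Ω φ F)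
    {χ : Amb d → ℝ} (hχ : IsTest χ) :
    IsFiniteEnergy Ω (fun z => χ z * φ z) (fun z => χ z • F z + φ z • grad χ z) where
  isH1Loc := h.isH1Loc.mul_contDiff hΩ hχ.1
  memLp_grad :=
    (LocL2.memLp_bilin_of_hasCompactSupport hΩ h.isH1Loc.memLp_grad
      (ContinuousLinearMap.lsmul ℝ ℝ).flip hχ.continuous hχ.2).add
    (LocL2.memLp_bilin_of_hasCompactSupport hΩ h.isH1Loc.memLp (ContinuousLinearMap.lsmul ℝ ℝ)
      hχ.continuous_grad hχ.hasCompactSupport_grad)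

theorem HasTrace.mul_isTest (ha : Admissible s b η) (h : HasTrace s b η φ 0)
    {χ : Amb d → ℝ} (hχ : IsTest χ) : HasTrace s b η (fun z => χ z * φ z) 0 := by
  obtain ⟨h0, F, hF, hG⟩ := h
  have hΩ := (isOpen_domain ha).measurableSet
  refine ⟨h0, _, hF.mul_contDiff hΩ hχ.1, fun Φ hΦ hd => ?_⟩
  have hts : tsupport (fun z => χ z * Φ z) ⊆ tsupport Φ :=
    closure_mono (Function.support_mul_subset_right χ Φ)
  have := hG _ (hΦ.mul_left hχ.1) (hd.mono_left hts)
  simp only [Pi.zero_apply, zero_mul, integral_zero, mul_zero] at this ⊢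
  rw [← this]
  congr 1
  ext z
  rw [fderiv_mul_apply' hχ.differentiable hΦ.differentiable]
  simp only [grad, Prod.snd_add, Prod.smul_snd, smul_eq_mul, riesz_snd]
  ring

end Sobolev

/-! ### Integration over vertical sections -/

section Vertical

variable {s : Phase} {b : Option (Hor d → ℝ)} {η : Hor d → ℝ}

/-- The open half-line starting at `a` in the direction pointing into the fluid. -/
def Phase.ray (s : Phase) (a : ℝ) : Set ℝ := {y | 0 < s.sign * (y - a)}

theorem Phase.ray_lower (a : ℝ) : Phase.lower.ray a = Iio a := by
  ext y; simp [Phase.ray, Phase.sign]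

theorem Phase.ray_upper (a : ℝ) : Phase.upper.ray a = Ioi a := by
  ext y; simp [Phase.ray, Phase.sign]

theorem Phase.isOpen_ray (s : Phase) (a : ℝ) : IsOpen (s.ray a) :=
  isOpen_lt continuous_const (by fun_prop)

theorem Phase.integral_ray_deriv (s : Phase) {h : ℝ → ℝ} (hh : ContDiff ℝ 1 h)
    (hc : HasCompactSupport h) (a : ℝ) : ∫ y in s.ray a, deriv h y = -s.sign * h a := by
  cases s
  · rw [Phase.ray_lower, ← integral_Iic_eq_integral_Iio, hc.integral_Iic_deriv_eq hh]
    simp [Phase.sign]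
  · rw [Phase.ray_upper, hc.integral_Ioi_deriv_eq hh]
    simp [Phase.sign]

/-- The part of the vertical line through `x` between height `a` and the rigid boundary. -/
def Phase.column (s : Phase) (b : Option (Hor d → ℝ)) (x : Hor d) (a : ℝ) : Set ℝ :=
  {y | 0 < s.sign * (y - a) ∧ ∀ b₀ ∈ b, 0 < s.sign * (b₀ x - y)}

theorem Phase.measurableSet_column (s : Phase) (b : Option (Hor d → ℝ)) (x : Hor d) (a : ℝ) :
    MeasurableSet (s.column b x a) := by
  have h1 := (s.isOpen_ray a).measurableSet
  rcases b with _ | b₀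
  · simpa [Phase.column, Phase.ray] using h1
  · have h2 : IsOpen {y : ℝ | 0 < s.sign * (b₀ x - y)} :=
      isOpen_lt continuous_const (by fun_prop)
    simpa [Phase.column, Phase.ray, ofPred_and] using h1.inter h2.measurableSet

theorem Phase.integral_column_deriv {x : Hor d} {h : ℝ → ℝ} (hh : ContDiff ℝ 1 h)
    (hc : HasCompactSupport h) (hb : ∀ b₀ ∈ b, h (b₀ x) = 0) {a : ℝ}
    (ha : ∀ b₀ ∈ b, 0 < s.sign * (b₀ x - a)) :
    ∫ y in s.column b x a, deriv h y = -s.sign * h a := by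
  rcases b with _ | b₀
  · simpa [Phase.column, Phase.ray] using s.integral_ray_deriv hh hc a
  -- The column is the ray from a minus the closed half-line starting at the wall. The fundamental
  -- theorem of calculus applies to each half-line, and the wall contributes nothing because h
  -- vanishes there.
  have hset : s.column (some b₀) x a = s.ray a \ {y | 0 ≤ s.sign * (y - b₀ x)} := by
    ext y
    simp only [Phase.column, Option.mem_def, Option.some.injEq, forall_eq', mem_ofPred_eq,
      Phase.ray, mem_sdiff, not_le]
    refine and_congr_right fun _ => ?_
    constructor <;> intro h <;> linarith
  have hint : Integrable (deriv h) :=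
    (hh.continuous_deriv le_rfl).integrable_of_hasCompactSupport hc.deriv
  have hcl : IsClosed {y | 0 ≤ s.sign * (y - b₀ x)} :=
    isClosed_le continuous_const (by fun_prop)
  have hae : {y | 0 ≤ s.sign * (y - b₀ x)} =ᵐ[volume] s.ray (b₀ x) := by
    have hnull : ∀ᵐ y : ℝ, y ≠ b₀ x := by simp [ae_iff]
    filter_upwards [hnull] with y hy
    have : s.sign * (y - b₀ x) ≠ 0 := mul_ne_zero s.sign_ne_zero (sub_ne_zero.2 hy)
    exact propext ⟨fun h => lt_of_le_of_ne h this.symm, fun h => le_of_lt h⟩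
  rw [hset, setIntegral_sdiff hcl.measurableSet hint.integrableOn, setIntegral_congr_set hae,
    s.integral_ray_deriv hh hc, s.integral_ray_deriv hh hc, hb b₀ rfl]
  · simp
  · intro y hy
    have h1 := ha b₀ rfl
    have h2 : 0 ≤ s.sign * (y - b₀ x) := hy
    change 0 < s.sign * (y - a)
    linarith

theorem setIntegral_eq_integral_section {Ω : Set (Amb d)} (hΩ : MeasurableSet Ω) {g : Amb d → ℝ}
    (hg : IntegrableOn g Ω) :
    ∫ z in Ω, g z = ∫ x, ∫ y in {y | (x, y) ∈ Ω}, g (x, y) := by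
  rw [← integral_indicator hΩ, Measure.volume_eq_prod, integral_prod]
  · congr 1
    ext x
    exact integral_indicator (measurable_prodMk_left hΩ)
  · exact (integrable_indicator_iff hΩ).2 hg

theorem deriv_vertical {Φ : Amb d → ℝ} (h : Differentiable ℝ Φ) (x : Hor d) (y : ℝ) :
    deriv (fun y => Φ (x, y)) y = fderiv ℝ Φ (x, y) (0, 1) := by
  have h1 : HasDerivAt (fun y : ℝ => ((x, y) : Amb d)) (0, 1) y :=
    (hasDerivAt_const y x).prodMk (hasDerivAt_id y)
  exact ((h (x, y)).hasFDerivAt.comp_hasDerivAt y h1).deriv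

theorem IsTest.vertical {Φ : Amb d → ℝ} (h : IsTest Φ) (x : Hor d) :
    IsTest fun y => Φ (x, y) := by
  refine ⟨h.1.comp (contDiff_const.prodMk contDiff_id), ?_⟩
  refine HasCompactSupport.intro (h.2.isCompact.image continuous_snd) fun y hy => ?_
  by_contra h0
  exact hy ⟨(x, y), subset_tsupport _ h0, rfl⟩

theorem eq_zero_of_mem_wall {Φ : Amb d → ℝ} (hd : Disjoint (tsupport Φ) (wall b)) {z : Amb d}
    (hz : z ∈ wall b) : Φ z = 0 := by
  by_contra h0
  exact Set.disjoint_left.1 hd (subset_tsupport _ h0) hz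

theorem IsTest.integral_column {Φ : Amb d → ℝ} (hΦ : IsTest Φ)
    (hd : Disjoint (tsupport Φ) (wall b)) {x : Hor d} {a : ℝ}
    (ha : ∀ b₀ ∈ b, 0 < s.sign * (b₀ x - a)) :
    ∫ y in s.column b x a, fderiv ℝ Φ (x, y) (0, 1) = -s.sign * Φ (x, a) := by
  have := Phase.integral_column_deriv (s := s) (b := b) (x := x)
    ((hΦ.vertical x).1.of_le (by simp)) (hΦ.vertical x).2
    (fun b₀ hb => eq_zero_of_mem_wall hd ⟨b₀, hb, rfl⟩) ha
  simpa only [deriv_vertical hΦ.differentiable] using this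

theorem Admissible.separated_pos (ha : Admissible s b η) (x : Hor d) :
    ∀ b₀ ∈ b, 0 < s.sign * (b₀ x - η x) := by
  obtain ⟨h, hh, hs⟩ := ha.separated
  exact fun b₀ hb => hh.trans_le (hs b₀ hb x)

theorem IsTest.integral_vertical_fderiv (ha : Admissible s b η) {Φ : Amb d → ℝ} (hΦ : IsTest Φ)
    (hd : Disjoint (tsupport Φ) (wall b)) :
    ∫ z in s.domain b η, fderiv ℝ Φ z (0, 1) = -s.sign * ∫ x, Φ (x, η x) := by
  rw [setIntegral_eq_integral_section (isOpen_domain ha).measurableSet, ← integral_const_mul]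
  · congr 1
    ext x
    exact hΦ.integral_column hd (ha.separated_pos x)
  · exact ((hΦ.fderiv_apply _).continuous.integrable_of_hasCompactSupport
      (hΦ.fderiv_apply _).2).integrableOn

/-- Consistency of the weak trace with restriction: integrate ∂_y(ΨΦ) over each column. It is needed
for Ψ = y, whose trace is η and which carries the gravity term. -/
theorem hasTrace_of_contDiff (ha : Admissible s b η) {Ψ : Amb d → ℝ} (hΨ : ContDiff ℝ ∞ Ψ) :
    HasTrace s b η Ψ fun x => Ψ (x, η x) := by
  have hη := ha.continuous
  have hΨc := hΨ.continuous
  refine ⟨Continuous.locallyIntegrable (by fun_prop), grad Ψ,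
    isH1Loc_of_contDiff (isOpen_domain ha).measurableSet hΨ, fun Φ hΦ hd => ?_⟩
  have hts : tsupport (fun z => Ψ z * Φ z) ⊆ tsupport Φ :=
    closure_mono (Function.support_mul_subset_right Ψ Φ)
  rw [← (hΦ.mul_left hΨ).integral_vertical_fderiv ha (hd.mono_left hts)]
  congr 1
  ext z
  rw [fderiv_mul_apply' (hΨ.differentiable (by simp)) hΦ.differentiable]
  simp only [grad, riesz_snd]
  ring

theorem grad_snd (z : Amb d) : grad (fun z : Amb d => z.2) z = (0, 1) := by
  have : fderiv ℝ (fun z : Amb d => z.2) z = ContinuousLinearMap.snd ℝ (Hor d) ℝ :=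
    (ContinuousLinearMap.snd ℝ (Hor d) ℝ).fderiv
  rw [grad, this]
  ext1
  · have : (ContinuousLinearMap.snd ℝ (Hor d) ℝ).comp (ContinuousLinearMap.inl ℝ (Hor d) ℝ) = 0 := by
      ext; simp
    simp [riesz, this]
  · simp

/-! ### The primitive vanishing on the interface -/

/-- The primitive in the vertical direction of `h`, vanishing on the interface. -/
def vertInt (η : Hor d → ℝ) (h : Amb d → ℝ) (z : Amb d) : ℝ := ∫ y in (η z.1)..z.2, h (z.1, y)

theorem stronglyMeasurable_vertInt (hη : Continuous η) {h : Amb d → ℝ}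
    (hm : StronglyMeasurable h) : StronglyMeasurable (vertInt η h) := by
  have hη' := hη.measurable
  have key : ∀ A B : Amb d → ℝ, Measurable A → Measurable B →
      StronglyMeasurable fun z : Amb d => ∫ y in Ioc (A z) (B z), h (z.1, y) := by
    intro A B hA hB
    have hset : MeasurableSet {q : Amb d × ℝ | q.2 ∈ Ioc (A q.1) (B q.1)} :=
      MeasurableSet.inter
        (measurableSet_lt (f := fun q : Amb d × ℝ => A q.1) (g := fun q => q.2)
          (by fun_prop) (by fun_prop))
        (measurableSet_le (f := fun q : Amb d × ℝ => q.2) (g := fun q => B q.1)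
          (by fun_prop) (by fun_prop))
    have hq : StronglyMeasurable fun q : Amb d × ℝ => h (q.1.1, q.2) :=
      hm.comp_measurable (by fun_prop)
    have := (hq.indicator hset).integral_prod_right' (ν := (volume : Measure ℝ))
    convert this using 2 with z
    rw [← integral_indicator measurableSet_Ioc]
    rfl
  unfold vertInt
  simp only [intervalIntegral]
  exact (key _ _ (by fun_prop) (by fun_prop)).sub (key _ _ (by fun_prop) (by fun_prop))

/-- Cauchy–Schwarz on the vertical segment between the interface and z. -/
theorem enorm_vertInt_sq_le {h : Amb d → ℝ} (hm : StronglyMeasurable h) (z : Amb d) :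
    ‖vertInt η h z‖ₑ ^ 2 ≤ ENNReal.ofReal |z.2 - η z.1| * ∫⁻ y, ‖h (z.1, y)‖ₑ ^ 2 := by
  set ν := (volume : Measure ℝ).restrict (uIoc (η z.1) z.2)
  have hk : StronglyMeasurable fun y => h (z.1, y) := hm.comp_measurable (by fun_prop)
  have h1 : ‖vertInt η h z‖ₑ ≤ ∫⁻ y, ‖h (z.1, y)‖ₑ ∂ν := by
    rw [vertInt, ← ofReal_norm, intervalIntegral.norm_intervalIntegral_eq, ofReal_norm]
    exact enorm_integral_le_lintegral_enorm _
  have h2 := eLpNorm_le_eLpNorm_mul_rpow_measure_univ (μ := ν) (p := 1) (q := 2) one_le_two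
    hk.aestronglyMeasurable
  rw [eLpNorm_one_eq_lintegral_enorm] at h2
  have h3 : eLpNorm (fun y => h (z.1, y)) 2 ν ^ 2 = ∫⁻ y, ‖h (z.1, y)‖ₑ ^ 2 ∂ν := by
    simpa using eLpNorm_nnreal_pow_eq_lintegral (μ := ν) (f := fun y => h (z.1, y)) (p := 2)
      (by simp)
  have h4 : ν univ = ENNReal.ofReal |z.2 - η z.1| := by
    simp [ν, uIoc, Real.volume_Ioc, max_sub_min_eq_abs]
  calc ‖vertInt η h z‖ₑ ^ 2
      ≤ (eLpNorm (fun y => h (z.1, y)) 2 ν *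
          ν univ ^ (1 / (1 : ENNReal).toReal - 1 / (2 : ENNReal).toReal)) ^ 2 := by
        gcongr; exact h1.trans h2
    _ = ENNReal.ofReal |z.2 - η z.1| * ∫⁻ y, ‖h (z.1, y)‖ₑ ^ 2 ∂ν := by
        rw [mul_pow, h3, h4, ← ENNReal.rpow_natCast, ← ENNReal.rpow_mul]
        norm_num
        rw [mul_comm]
    _ ≤ _ := by
        gcongr
        exact Measure.restrict_le_self

/-- The pointwise bound depends on the height only through the factor |y - η| ≤ M. Since the norm is
the maximum norm, the ball is a cylinder of height 2R, and integrating in y gives the constant 2RM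
for the squared norms. -/
theorem eLpNorm_vertInt_le {h : Amb d → ℝ} (hm : StronglyMeasurable h) {R M K : ℝ}
    (hK : 0 ≤ K) (hM : ∀ x y, ‖x‖ < R → |y| < R → |y - η x| ≤ M) (hMK : 2 * R * M ≤ K ^ 2) :
    eLpNorm (vertInt η h) 2 (volume.restrict (Metric.ball 0 R)) ≤
      ENNReal.ofReal K * eLpNorm h 2 volume := by
  have hsq : ∀ (μ : Measure (Amb d)) (f : Amb d → ℝ),
      eLpNorm f 2 μ ^ 2 = ∫⁻ z, ‖f z‖ₑ ^ 2 ∂μ := fun μ f => by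
    simpa using eLpNorm_nnreal_pow_eq_lintegral (μ := μ) (f := f) (p := 2) (by simp)
  rcases lt_or_ge 0 R with hR | hR
  swap
  · simp [Metric.ball_eq_empty.2 hR]
  have hM0 : 0 ≤ M := (abs_nonneg _).trans (hM 0 0 (by simpa) (by simpa))
  have hhm : Measurable fun z => ‖h z‖ₑ ^ 2 := hm.measurable.enorm.pow_const 2
  have hN : Measurable fun x => ∫⁻ y, ‖h (x, y)‖ₑ ^ 2 := hhm.lintegral_prod_right'
  rw [← ENNReal.pow_le_pow_left_iff two_ne_zero, mul_pow, hsq, hsq]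
  calc ∫⁻ z in Metric.ball (0 : Amb d) R, ‖vertInt η h z‖ₑ ^ 2
      ≤ ∫⁻ z in Metric.ball (0 : Amb d) R, ENNReal.ofReal M * ∫⁻ y, ‖h (z.1, y)‖ₑ ^ 2 := by
        refine setLIntegral_mono' Metric.isOpen_ball.measurableSet fun z hz => ?_
        refine (enorm_vertInt_sq_le hm z).trans ?_
        rw [mem_ball_zero_iff, Prod.norm_def, max_lt_iff] at hz
        gcongr
        exact hM _ _ hz.1 hz.2
    _ = ∫⁻ x in Metric.ball (0 : Hor d) R, ∫⁻ s in Metric.ball (0 : ℝ) R,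
          ENNReal.ofReal M * ∫⁻ y, ‖h (x, y)‖ₑ ^ 2 := by
        have : Metric.ball (0 : Amb d) R = Metric.ball (0 : Hor d) R ×ˢ Metric.ball (0 : ℝ) R :=
          (ball_prod_same (0 : Hor d) (0 : ℝ) R).symm
        rw [this, Measure.volume_eq_prod, ← Measure.prod_restrict, lintegral_prod]
        exact ((hN.comp measurable_fst).const_mul _).aemeasurable
    _ = ∫⁻ x in Metric.ball (0 : Hor d) R,
          ENNReal.ofReal (2 * R * M) * ∫⁻ y, ‖h (x, y)‖ₑ ^ 2 := by
        congr 1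
        ext x
        rw [lintegral_const, Measure.restrict_apply_univ, Real.volume_ball,
          mul_comm (2 * R) M, ENNReal.ofReal_mul hM0]
        ring
    _ ≤ ∫⁻ x, ENNReal.ofReal (2 * R * M) * ∫⁻ y, ‖h (x, y)‖ₑ ^ 2 :=
        lintegral_mono' Measure.restrict_le_self le_rfl
    _ = ENNReal.ofReal (2 * R * M) * ∫⁻ z, ‖h z‖ₑ ^ 2 := by
        rw [lintegral_const_mul _ hN, Measure.volume_eq_prod, lintegral_prod _ hhm.aemeasurable]
    _ ≤ _ := by
        rw [← ENNReal.ofReal_pow hK]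
        gcongr

theorem exists_abs_sub_le (hη : Continuous η) (R : ℝ) :
    ∃ M, ∀ x y, ‖x‖ < R → |y| < R → |y - η x| ≤ M := by
  obtain ⟨C, hC⟩ := (isCompact_closedBall (0 : Hor d) R).exists_bound_of_continuousOn
    hη.continuousOn
  refine ⟨R + C, fun x y hx hy => ?_⟩
  have := hC x (by simpa using hx.le)
  rw [Real.norm_eq_abs] at this
  exact (abs_sub y (η x)).trans (by linarith)

theorem memLp_vertInt (hη : Continuous η) {h : Amb d → ℝ} (hm : StronglyMeasurable h)
    (hL : MemLp h 2 volume) (R : ℝ) :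
    MemLp (vertInt η h) 2 (volume.restrict (Metric.ball 0 R)) := by
  obtain ⟨M, hM⟩ := exists_abs_sub_le hη R
  refine ⟨(stronglyMeasurable_vertInt hη hm).aestronglyMeasurable, ?_⟩
  refine (eLpNorm_vertInt_le hm (K := Real.sqrt (max 0 (2 * R * M))) (Real.sqrt_nonneg _) hM
    ?_).trans_lt (ENNReal.mul_lt_top ENNReal.ofReal_lt_top hL.2)
  rw [Real.sq_sqrt (le_max_left _ _)]
  exact le_max_right _ _

theorem locL2_vertInt (hη : Continuous η) {h : Amb d → ℝ} (hm : StronglyMeasurable h)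
    (hL : MemLp h 2 volume) (Ω : Set (Amb d)) : LocL2 Ω (vertInt η h) := fun R =>
  (memLp_vertInt hη hm hL R).mono_measure (Measure.restrict_mono inter_subset_right le_rfl)

end Vertical

/-! ### Duality between the two vertical primitives -/

section Duality

variable {s : Phase} {b : Option (Hor d → ℝ)} {η : Hor d → ℝ}

/-- The integral of `g` from `z` vertically up to the rigid boundary. -/
def tailInt (s : Phase) (b : Option (Hor d → ℝ)) (g : Amb d → ℝ) (z : Amb d) : ℝ :=
  ∫ y in s.column b z.1 z.2, g (z.1, y)

theorem tailInt_fderiv {Φ : Amb d → ℝ} (hΦ : IsTest Φ) (hd : Disjoint (tsupport Φ) (wall b))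
    {z : Amb d} (hz : z ∈ s.domain b η) :
    tailInt s b (fun z => fderiv ℝ Φ z (0, 1)) z = -s.sign * Φ z :=
  hΦ.integral_column hd (x := z.1) (a := z.2) hz.2

/-- The interval integral is oriented upward, while rays point into the fluid; below the interface
the two orientations differ, whence the sign. -/
theorem intervalIntegral_eq_sign_mul (s : Phase) {k : ℝ → ℝ} {e t : ℝ} (ht : t ∈ s.ray e) :
    ∫ y in e..t, k y = s.sign * ∫ y in {y | y ∈ s.ray e ∧ t ∈ s.ray y}, k y := by
  cases s
  · have ht' : t < e := by simpa [Phase.ray_lower] using ht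
    have : {y | y ∈ Phase.lower.ray e ∧ t ∈ Phase.lower.ray y} = Ioo t e := by
      ext y; simp [Phase.ray_lower, and_comm]
    rw [this, intervalIntegral.integral_of_ge ht'.le, integral_Ioc_eq_integral_Ioo]
    simp [Phase.sign]
  · have ht' : e < t := by simpa [Phase.ray_upper] using ht
    have : {y | y ∈ Phase.upper.ray e ∧ t ∈ Phase.upper.ray y} = Ioo e t := by
      ext y; simp [Phase.ray_upper]
    rw [this, intervalIntegral.integral_of_le ht'.le, integral_Ioc_eq_integral_Ioo]
    simp [Phase.sign]

/-- Both sides say that e, y, t and the wall occur in this order going into the fluid. They describe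
one region of integration in the two orders of Fubini's theorem. -/
theorem mem_column_and_ray_iff {x : Hor d} {e t y : ℝ} :
    (t ∈ s.column b x e ∧ y ∈ s.ray e ∧ t ∈ s.ray y) ↔
      (y ∈ s.column b x e ∧ t ∈ s.column b x y) := by
  simp only [Phase.column, Phase.ray, mem_ofPred_eq]
  constructor
  · rintro ⟨⟨h1, h2⟩, h3, h4⟩
    exact ⟨⟨h3, fun b₀ hb => by linarith [h2 b₀ hb]⟩, h4, h2⟩
  · rintro ⟨⟨h1, h2⟩, h3, h4⟩
    exact ⟨⟨by linarith, h4⟩, h1, h3⟩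

theorem abs_le_of_mem_ray {e t y R : ℝ} (h1 : y ∈ s.ray e) (h2 : t ∈ s.ray y) (he : |e| ≤ R)
    (ht : |t| ≤ R) : |y| ≤ R := by
  rw [abs_le] at *
  cases s
  · rw [Phase.ray_lower, mem_Iio] at h1 h2
    constructor <;> linarith
  · rw [Phase.ray_upper, mem_Ioi] at h1 h2
    constructor <;> linarith

/-- Fubini over the region where e, y, t and the wall are in order: t outside gives the primitive of
k from e, y outside gives the integral of g from y to the wall. -/
theorem integral_column_primitive_mul {k g : ℝ → ℝ} (hk : LocallyIntegrable k)
    (hg : Continuous g) (hgc : HasCompactSupport g) (x : Hor d) (e : ℝ) :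
    ∫ t in s.column b x e, (∫ y in e..t, k y) * g t =
      s.sign * ∫ y in s.column b x e, k y * ∫ t in s.column b x y, g t := by
  have hC := s.measurableSet_column b x
  set D : Set (ℝ × ℝ) := {q | q.1 ∈ s.column b x e ∧ q.2 ∈ s.ray e ∧ q.1 ∈ s.ray q.2} with hD
  have hDm : MeasurableSet D := by
    refine (measurable_fst (hC e)).inter
      ((measurable_snd (s.isOpen_ray e).measurableSet).inter ?_)
    exact (isOpen_lt (f := fun _ : ℝ × ℝ => (0 : ℝ)) (g := fun q => s.sign * (q.1 - q.2))
      continuous_const (by fun_prop)).measurableSet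
  have hint : Integrable (D.indicator fun q => g q.1 * k q.2)
      ((volume : Measure ℝ).prod volume) := by
    -- Local integrability of k suffices: on `D` the height y lies between e and t, so it stays in a
    -- fixed compact interval when g(t) ≠ 0.
    obtain ⟨R, hR⟩ := hgc.isBounded.subset_closedBall (0 : ℝ)
    set R' := max R |e|
    have h1 : Integrable (fun q : ℝ × ℝ => g q.1 * (Icc (-R') R').indicator k q.2)
        ((volume : Measure ℝ).prod volume) :=
      (hg.integrable_of_hasCompactSupport hgc).mul_prod
        ((integrable_indicator_iff measurableSet_Icc).2 (hk.integrableOn_isCompact isCompact_Icc))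
    refine (h1.indicator hDm).congr (Filter.Eventually.of_forall fun q => ?_)
    by_cases hq : q ∈ D
    · rw [indicator_of_mem hq, indicator_of_mem hq]
      by_cases h0 : g q.1 = 0
      · simp [h0]
      have hq1 : |q.1| ≤ R := by simpa using hR (subset_tsupport _ h0)
      have : |q.2| ≤ R' := abs_le_of_mem_ray hq.2.1 hq.2.2 (le_max_right _ _)
        (hq1.trans (le_max_left _ _))
      rw [indicator_of_mem (show q.2 ∈ Icc (-R') R' from abs_le.1 this)]
    · simp [hq]
  have hswap := integral_integral_swap (f := fun t y => D.indicator (fun q => g q.1 * k q.2) (t, y))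
    hint
  have hL : ∫ t in s.column b x e, (∫ y in e..t, k y) * g t =
      s.sign * ∫ t, ∫ y, D.indicator (fun q => g q.1 * k q.2) (t, y) := by
    rw [← integral_indicator (hC e), ← integral_const_mul]
    congr 1
    ext t
    by_cases ht : t ∈ s.column b x e
    · rw [indicator_of_mem ht, intervalIntegral_eq_sign_mul s ht.1, mul_assoc, mul_comm _ (g t),
        ← integral_const_mul, ← integral_indicator]
      · congr 2
        ext y
        by_cases hy : y ∈ s.ray e ∧ t ∈ s.ray y
        · rw [indicator_of_mem (show y ∈ {y | y ∈ s.ray e ∧ t ∈ s.ray y} from hy),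
            indicator_of_mem (show (t, y) ∈ D from ⟨ht, hy⟩)]
        · rw [indicator_of_notMem (show y ∉ {y | y ∈ s.ray e ∧ t ∈ s.ray y} from hy),
            indicator_of_notMem (show (t, y) ∉ D from fun h => hy h.2)]
      · refine (s.isOpen_ray e).measurableSet.inter ?_
        exact (isOpen_lt (f := fun _ : ℝ => (0 : ℝ)) (g := fun y => s.sign * (t - y))
          continuous_const (by fun_prop)).measurableSet
    · rw [indicator_of_notMem ht]
      have : ∀ y, D.indicator (fun q => g q.1 * k q.2) (t, y) = 0 := fun y =>
        indicator_of_notMem (fun h => ht h.1) _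
      simp [this]
  have hR : ∫ y in s.column b x e, k y * ∫ t in s.column b x y, g t =
      ∫ y, ∫ t, D.indicator (fun q => g q.1 * k q.2) (t, y) := by
    rw [← integral_indicator (hC e)]
    congr 1
    ext y
    by_cases hy : y ∈ s.column b x e
    · rw [indicator_of_mem hy, ← integral_const_mul, ← integral_indicator (hC y)]
      congr 1
      ext t
      by_cases ht : t ∈ s.column b x y
      · rw [indicator_of_mem ht,
          indicator_of_mem (show (t, y) ∈ D from mem_column_and_ray_iff.2 ⟨hy, ht⟩), mul_comm]
      · rw [indicator_of_notMem ht, indicator_of_notMem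
          (show (t, y) ∉ D from fun h => ht (mem_column_and_ray_iff.1 h).2)]
    · rw [indicator_of_notMem hy]
      have : ∀ t, D.indicator (fun q => g q.1 * k q.2) (t, y) = 0 := fun t =>
        indicator_of_notMem (s := D) (fun h => hy (mem_column_and_ray_iff.1 h).1) _
      simp [this]
  rw [hL, hR, hswap]

theorem isOpen_column (ha : Admissible s b η) :
    IsOpen {q : Amb d × ℝ | q.2 ∈ s.column b q.1.1 q.1.2} := by
  have h1 : IsOpen {q : Amb d × ℝ | 0 < s.sign * (q.2 - q.1.2)} :=
    isOpen_lt continuous_const (by fun_prop)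
  rcases b with _ | b₀
  · simpa [Phase.column] using h1
  · obtain ⟨L, hb⟩ := ha.lipschitz_wall b₀ rfl
    have hb := hb.continuous
    have h2 : IsOpen {q : Amb d × ℝ | 0 < s.sign * (b₀ q.1.1 - q.2)} :=
      isOpen_lt continuous_const (by fun_prop)
    simpa [Phase.column, ofPred_and] using h1.inter h2

theorem stronglyMeasurable_tailInt (ha : Admissible s b η) {g : Amb d → ℝ} (hg : Continuous g) :
    StronglyMeasurable (tailInt s b g) := by
  have hq : StronglyMeasurable fun q : Amb d × ℝ => g (q.1.1, q.2) :=
    hg.stronglyMeasurable.comp_measurable (by fun_prop)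
  have := (hq.indicator (isOpen_column ha).measurableSet).integral_prod_right'
    (ν := (volume : Measure ℝ))
  convert this using 2 with z
  rw [tailInt, ← integral_indicator (s.measurableSet_column b z.1 z.2)]
  rfl

/-- On the fluid side of the interface, a point z where the tail integral is nonzero lies vertically
between the interface and a point of the support of g, both at bounded height. Across the interface
the tail integral need not have bounded support. -/
theorem exists_tailInt_eq_zero (hη : Continuous η) {g : Amb d → ℝ} (hgc : HasCompactSupport g) :
    ∃ R, 0 < R ∧ ∀ z : Amb d, z.2 ∈ s.ray (η z.1) → z ∉ Metric.ball (0 : Amb d) R →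
      tailInt s b g z = 0 := by
  obtain ⟨R, hR0, hR⟩ := hgc.isBounded.subset_ball_lt 0 (0 : Amb d)
  obtain ⟨C, hC⟩ := (isCompact_closedBall (0 : Hor d) R).exists_bound_of_continuousOn
    hη.continuousOn
  refine ⟨max R C + 1, by positivity, fun z hz hzR => ?_⟩
  refine setIntegral_eq_zero_of_forall_eq_zero fun y hy => ?_
  by_contra h0
  have hy' := hR (subset_tsupport _ h0)
  rw [mem_ball_zero_iff, Prod.norm_def, max_lt_iff] at hy'
  refine hzR ?_
  have h1 := hC z.1 (by simpa using hy'.1.le)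
  have h2 : |z.2| ≤ max R C := abs_le_of_mem_ray hz hy.1 (h1.trans (le_max_right _ _))
    (hy'.2.le.trans (le_max_left _ _))
  rw [mem_ball_zero_iff, Prod.norm_def, max_lt_iff]
  have h3 : R ≤ max R C := le_max_left _ _
  rw [← Real.norm_eq_abs] at h2
  exact ⟨by linarith [hy'.1], by linarith⟩

theorem exists_abs_tailInt_le {g : Amb d → ℝ} (hg : Continuous g) (hgc : HasCompactSupport g) :
    ∃ C, ∀ z, ‖tailInt s b g z‖ ≤ C := by
  obtain ⟨R, hR0, hR⟩ := hgc.isBounded.subset_ball_lt 0 (0 : Amb d)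
  obtain ⟨C, hC⟩ := hg.bounded_above_of_compact_support hgc
  refine ⟨∫ _ in Metric.ball (0 : ℝ) R, C, fun z => ?_⟩
  have hb : ∀ y, ‖g (z.1, y)‖ ≤ (Metric.ball (0 : ℝ) R).indicator (fun _ => C) y := by
    intro y
    by_cases hy : y ∈ Metric.ball (0 : ℝ) R
    · rw [indicator_of_mem hy]; exact hC _
    · rw [indicator_of_notMem hy]
      by_contra h0
      have h0 : g (z.1, y) ≠ 0 := fun h => h0 (by simp [h])
      have hy' := hR (subset_tsupport _ h0)
      rw [mem_ball_zero_iff, Prod.norm_def, max_lt_iff] at hy'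
      exact hy (by simpa using hy'.2)
  have hi : Integrable ((Metric.ball (0 : ℝ) R).indicator fun _ => C) :=
    (integrable_indicator_iff Metric.isOpen_ball.measurableSet).2
      (integrableOn_const measure_ball_lt_top.ne)
  have hC0 : 0 ≤ C := (norm_nonneg _).trans (hC 0)
  rw [← integral_indicator Metric.isOpen_ball.measurableSet]
  refine (norm_integral_le_integral_norm _).trans ?_
  refine (integral_mono_of_nonneg (Filter.Eventually.of_forall fun _ => norm_nonneg _)
    hi.integrableOn (Filter.Eventually.of_forall hb)).trans ?_
  exact setIntegral_le_integral hi
    (Filter.Eventually.of_forall fun y => indicator_nonneg (fun _ _ => hC0) y)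

theorem memLp_tailInt (ha : Admissible s b η) {g : Amb d → ℝ} (hg : Continuous g)
    (hgc : HasCompactSupport g) : MemLp (tailInt s b g) 2 (volume.restrict (s.domain b η)) := by
  obtain ⟨R, -, hR⟩ := exists_tailInt_eq_zero (s := s) (b := b) ha.continuous hgc
  obtain ⟨C, hC⟩ := exists_abs_tailInt_le (s := s) (b := b) hg hgc
  refine memLp_of_inter_ball (isOpen_domain ha).measurableSet (R := R) ?_
    fun z hz hzR => hR z hz.1 hzR
  have : IsFiniteMeasure (volume.restrict (s.domain b η ∩ Metric.ball (0 : Amb d) R)) :=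
    ⟨by simpa using (measure_mono inter_subset_right).trans_lt measure_ball_lt_top⟩
  exact MemLp.of_bound (stronglyMeasurable_tailInt ha hg).aestronglyMeasurable C
    (Filter.Eventually.of_forall hC)

theorem ae_locallyIntegrable_section {h : Amb d → ℝ} (hm : StronglyMeasurable h)
    (hL : MemLp h 2 volume) : ∀ᵐ x : Hor d, LocallyIntegrable fun y => h (x, y) := by
  have h2 : Integrable (fun z => h z ^ 2) ((volume : Measure (Hor d)).prod volume) :=
    hL.integrable_sq
  filter_upwards [h2.prod_right_ae] with x hx
  have hk : StronglyMeasurable fun y => h (x, y) := hm.comp_measurable (by fun_prop)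
  exact ((memLp_two_iff_integrable_sq hk.aestronglyMeasurable).2 hx).locallyIntegrable one_le_two

/-- `vertInt` and `tailInt` are adjoint up to the sign of the phase, by the one-dimensional identity
on almost every column. This turns statements about the primitive of h into L² pairings with h
itself. -/
theorem integral_vertInt_mul (ha : Admissible s b η) {h : Amb d → ℝ} (hm : StronglyMeasurable h)
    (hL : MemLp h 2 volume) {g : Amb d → ℝ} (hg : Continuous g) (hgc : HasCompactSupport g) :
    ∫ z in s.domain b η, vertInt η h z * g z =
      s.sign * ∫ z in s.domain b η, h z * tailInt s b g z := by
  have hΩ := (isOpen_domain ha).measurableSet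
  rw [setIntegral_eq_integral_section hΩ
      ((locL2_vertInt ha.continuous hm hL _).integrable_mul hΩ hg hgc),
    setIntegral_eq_integral_section (g := fun z => h z * tailInt s b g z) hΩ
      ((hL.restrict _).integrable_mul (memLp_tailInt ha hg hgc)), ← integral_const_mul]
  refine integral_congr_ae ?_
  filter_upwards [ae_locallyIntegrable_section hm hL] with x hx
  refine integral_column_primitive_mul (g := fun y => g (x, y)) hx (by fun_prop) ?_ x (η x)
  refine HasCompactSupport.intro (hgc.isCompact.image continuous_snd) fun y hy => ?_
  by_contra h0
  exact hy ⟨(x, y), subset_tsupport _ h0, rfl⟩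

end Duality

/-! ### Functions with vanishing trace -/

section Representation

variable {s : Phase} {b : Option (Hor d → ℝ)} {η : Hor d → ℝ}

theorem column_none (s : Phase) (x : Hor d) (a : ℝ) : s.column none x a = s.ray a := by
  simp [Phase.column, Phase.ray]

/-- With no wall, the tail integral is the convolution in y of g(x, ·) with the indicator of a
half-line, hence smooth. Integrating only up to a Lipschitz wall would not give this for general g.
-/
theorem contDiff_tailInt_none {g : Amb d → ℝ} (hg : IsTest g) :
    ContDiff ℝ ∞ (tailInt s none g) := by
  have hf : LocallyIntegrable ({r : ℝ | 0 < s.sign * (-r)}.indicator fun _ => (1 : ℝ)) := by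
    have : IsOpen {r : ℝ | 0 < s.sign * (-r)} := isOpen_lt continuous_const (by fun_prop)
    exact (locallyIntegrable_const 1).indicator this.measurableSet
  have := contDiffOn_convolution_right_with_param (n := ⊤) (ContinuousLinearMap.mul ℝ ℝ)
    (g := fun (x : Hor d) y => g (x, y)) (s := univ) (k := Prod.snd '' tsupport g)
    isOpen_univ (hg.2.isCompact.image continuous_snd) (fun x y _ hy => by
      by_contra h0
      exact hy ⟨(x, y), subset_tsupport _ h0, rfl⟩) hf hg.1.contDiffOn
  rw [univ_prod_univ, contDiffOn_univ] at this
  convert this using 1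
  ext ⟨x, t⟩
  rw [tailInt, column_none, ← integral_indicator (s.isOpen_ray t).measurableSet,
    ← integral_sub_left_eq_self _ _ t]
  refine integral_congr_ae (Filter.Eventually.of_forall fun r => ?_)
  have : t - r ∈ s.ray t ↔ r ∈ {r : ℝ | 0 < s.sign * (-r)} := by
    simp [Phase.ray]
  by_cases hr : r ∈ {r : ℝ | 0 < s.sign * (-r)}
  · simp only [indicator_of_mem hr, indicator_of_mem (this.2 hr)]
    simp
  · simp only [indicator_of_notMem hr, indicator_of_notMem (mt this.1 hr)]
    simp

theorem Phase.integral_ray_eq (s : Phase) {k : ℝ → ℝ} (hk : Integrable k) (y : ℝ) :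
    ∫ t in s.ray y, k t = (∫ t in s.ray 0, k t) - s.sign * ∫ t in (0 : ℝ)..y, k t := by
  cases s
  · have := intervalIntegral.integral_Iic_sub_Iic (hk.integrableOn (s := Iic 0))
      (hk.integrableOn (s := Iic y))
    rw [ray_lower, ray_lower, ← integral_Iic_eq_integral_Iio, ← integral_Iic_eq_integral_Iio,
      ← this]
    simp [Phase.sign]
  · have := intervalIntegral.integral_Ioi_sub_Ioi' (hk.integrableOn (s := Ioi 0))
      (hk.integrableOn (s := Ioi y))
    rw [ray_upper, ray_upper, ← this]
    simp [Phase.sign]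

theorem fderiv_tailInt_none {g : Amb d → ℝ} (hg : IsTest g) (z : Amb d) :
    fderiv ℝ (tailInt s none g) z (0, 1) = -s.sign * g z := by
  obtain ⟨x, y⟩ := z
  have hk := hg.vertical x
  rw [← deriv_vertical ((contDiff_tailInt_none hg).differentiable (by simp))]
  have h1 : (fun y => tailInt s none g (x, y)) = fun y => (∫ t in s.ray 0, g (x, t)) -
      s.sign * ∫ t in (0 : ℝ)..y, g (x, t) := by
    ext y
    rw [tailInt, column_none]
    exact s.integral_ray_eq (hk.continuous.integrable_of_hasCompactSupport hk.2) y
  have h2 : HasDerivAt (fun y => ∫ t in (0 : ℝ)..y, g (x, t)) (g (x, y)) y :=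
    (hk.continuous.integral_hasStrictDerivAt 0 y).hasDerivAt
  rw [h1, ((h2.const_mul s.sign).const_sub _).deriv]
  ring

/-- The tail integral lives on the support of g translated vertically away from the wall. A compact
set plus a closed half-line is closed, and such translations cannot reach the wall. -/
theorem exists_isClosed_support_tailInt_none {g : Amb d → ℝ} (hgc : HasCompactSupport g)
    (hgs : tsupport g ⊆ s.domain b η) :
    ∃ S, IsClosed S ∧ Disjoint S (wall b) ∧ Function.support (tailInt s none g) ⊆ S := by
  have hcl : IsClosed {z : Amb d | z.1 = 0 ∧ 0 ≤ s.sign * (-z.2)} :=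
    (isClosed_eq continuous_fst continuous_const).inter
      (isClosed_le (f := fun _ => (0 : ℝ)) (g := fun z : Amb d => s.sign * (-z.2))
        continuous_const (by fun_prop))
  refine ⟨_, hcl.add_left_of_isCompact hgc.isCompact, ?_, ?_⟩
  · rw [Set.disjoint_left]
    rintro _ ⟨p, hp, q, ⟨hq1, hq2⟩, rfl⟩ ⟨b₀, hb, hz⟩
    have h1 := (hgs hp).2 b₀ hb
    simp only [Prod.snd_add, Prod.fst_add, hq1, add_zero] at hz
    rw [← hz] at h1
    linarith
  · intro z hz
    obtain ⟨y, hy, h0⟩ : ∃ y ∈ s.ray z.2, g (z.1, y) ≠ 0 := by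
      by_contra! h
      refine hz ?_
      rw [tailInt, column_none]
      exact setIntegral_eq_zero_of_forall_eq_zero h
    refine ⟨(z.1, y), subset_tsupport _ h0, (0, z.2 - y), ⟨rfl, ?_⟩, by simp⟩
    have : 0 < s.sign * (y - z.2) := hy
    simpa using this.le

theorem tailInt_eq_tailInt_none {g : Amb d → ℝ} (hgs : tsupport g ⊆ s.domain b η) (z : Amb d) :
    tailInt s b g z = tailInt s none g z := by
  rw [tailInt, tailInt, column_none]
  symm
  refine setIntegral_eq_of_subset_of_forall_sdiff_eq_zero (s.isOpen_ray _).measurableSet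
    (fun y hy => hy.1) fun y hy => ?_
  by_contra h0
  exact hy.2 ⟨hy.1, (hgs (subset_tsupport _ h0)).2⟩

/-! ### Cutoff functions -/

/-- A fixed smooth bump function, equal to `1` on the unit ball. -/
def unitBump (d : ℕ) : ContDiffBump (0 : Amb d) := ⟨1, 2, one_pos, one_lt_two⟩

/-- A smooth function equal to `1` on the ball of radius `R` and to `0` off that of radius `2R`. -/
def cutoff (R : ℝ) (z : Amb d) : ℝ := unitBump d (R⁻¹ • z)

theorem cutoff_eq_one {R : ℝ} (hR : 0 < R) {z : Amb d} (hz : ‖z‖ ≤ R) : cutoff R z = 1 := by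
  refine (unitBump d).one_of_mem_closedBall ?_
  rw [mem_closedBall_zero_iff, norm_smul, norm_inv, Real.norm_of_nonneg hR.le]
  change R⁻¹ * ‖z‖ ≤ 1
  rw [inv_mul_le_iff₀ hR, mul_one]
  exact hz

theorem cutoff_eq_zero {R : ℝ} (hR : 0 < R) {z : Amb d} (hz : 2 * R ≤ ‖z‖) : cutoff R z = 0 := by
  refine (unitBump d).zero_of_le_dist ?_
  rw [dist_zero_right, norm_smul, norm_inv, Real.norm_of_nonneg hR.le]
  change 2 ≤ R⁻¹ * ‖z‖
  rw [le_inv_mul_iff₀ hR, mul_comm]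
  exact hz

theorem abs_cutoff_le (R : ℝ) (z : Amb d) : |cutoff R z| ≤ 1 := by
  rw [abs_of_nonneg (show 0 ≤ cutoff R z from (unitBump d).nonneg)]
  exact (unitBump d).le_one

theorem support_cutoff_subset {R : ℝ} (hR : 0 < R) :
    Function.support (cutoff R : Amb d → ℝ) ⊆ Metric.closedBall 0 (2 * R) := by
  intro z hz
  rw [mem_closedBall_zero_iff]
  by_contra! h
  exact hz (cutoff_eq_zero hR h.le)

theorem isTest_cutoff {R : ℝ} (hR : 0 < R) : IsTest (cutoff R : Amb d → ℝ) :=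
  ⟨(unitBump d).contDiff.comp (contDiff_const_smul _),
    HasCompactSupport.of_support_subset_isCompact (isCompact_closedBall _ _)
      (support_cutoff_subset hR)⟩

theorem fderiv_cutoff (R : ℝ) (z : Amb d) :
    fderiv ℝ (cutoff R) z = R⁻¹ • fderiv ℝ (unitBump d) (R⁻¹ • z) := by
  have := fderiv_comp_smul (𝕜 := ℝ) (f := (unitBump d : Amb d → ℝ)) (R⁻¹) (x := z)
  exact this

theorem fderiv_cutoff_eq_zero {R : ℝ} (hR : 0 < R) {z : Amb d} (hz : ‖z‖ < R) :
    fderiv ℝ (cutoff R) z = 0 := by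
  have : (cutoff R : Amb d → ℝ) =ᶠ[nhds z] fun _ => 1 := by
    filter_upwards [Metric.isOpen_ball.mem_nhds (mem_ball_zero_iff.2 hz)] with y hy
    exact cutoff_eq_one hR (mem_ball_zero_iff.1 hy).le
  rw [this.fderiv_eq]
  simp

theorem exists_norm_fderiv_cutoff_le (d : ℕ) :
    ∃ C, 0 ≤ C ∧ ∀ R > 0, ∀ z : Amb d, ‖fderiv ℝ (cutoff R) z‖ ≤ C / R := by
  have h1 : ContDiff ℝ ∞ (unitBump d : Amb d → ℝ) := (unitBump d).contDiff
  obtain ⟨C, hC⟩ := (h1.continuous_fderiv (by simp)).bounded_above_of_compact_support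
    ((unitBump d).hasCompactSupport.fderiv (𝕜 := ℝ))
  refine ⟨C, (norm_nonneg _).trans (hC 0), fun R hR z => ?_⟩
  rw [fderiv_cutoff, norm_smul, norm_inv, Real.norm_of_nonneg hR.le, div_eq_inv_mul]
  gcongr
  exact hC _

/-- A function with zero trace is the vertical primitive of its vertical derivative. -/
theorem HasTrace.ae_eq_vertInt (ha : Admissible s b η) {w : Amb d → ℝ} {W : Amb d → Amb d}
    (hW : IsH1Loc (s.domain b η) w W) (htr : HasTrace s b η w 0) {h : Amb d → ℝ}
    (hm : StronglyMeasurable h) (hL : MemLp h 2 volume)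
    (hh : ∀ᵐ z ∂(volume.restrict (s.domain b η)), (W z).2 = h z) :
    ∀ᵐ z ∂(volume.restrict (s.domain b η)), w z = vertInt η h z := by
  have hΩo := isOpen_domain ha
  have hΩ := hΩo.measurableSet
  have hT := locL2_vertInt ha.continuous hm hL (s.domain b η)
  have hD : LocL2 (s.domain b η) (fun z => w z - vertInt η h z) := by
    simpa [sub_eq_add_neg] using LocL2.add hW.memLp (hT.const_smul (-1))
  rw [ae_restrict_iff' hΩ]
  have key := hΩo.ae_eq_zero_of_integral_contDiff_smul_eq_zero (hD.locallyIntegrableOn hΩo)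
    (fun g hg hgc hgs => ?_)
  · filter_upwards [key] with z hz hzΩ
    exact sub_eq_zero.1 (hz hzΩ)
  have hgt : IsTest g := ⟨hg, hgc⟩
  have hzero : ∀ z, z ∉ s.domain b η → g z • (w z - vertInt η h z) = 0 := by
    intro z hz
    have : g z = 0 := by
      by_contra h0
      exact hz (hgs (subset_tsupport _ h0))
    simp [this]
  rw [← setIntegral_eq_integral_of_forall_compl_eq_zero hzero]
  -- The test function for Green's formula is the wall-free tail integral of g, whose vertical
  -- derivative is ∓g. It may extend to infinity across the interface, so it is multiplied by a
  -- cutoff; R is large enough that the cutoff changes nothing inside the fluid.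
  obtain ⟨R₁, hR₁, hR₁'⟩ := exists_tailInt_eq_zero (s := s) (b := none) ha.continuous hgc
  obtain ⟨R₂, hR₂⟩ := hgc.isBounded.subset_ball (0 : Amb d)
  set R := max R₁ R₂
  have hR : 0 < R := hR₁.trans_le (le_max_left _ _)
  have hout : ∀ z ∈ s.domain b η, R ≤ ‖z‖ → tailInt s none g z = 0 ∧ g z = 0 := by
    intro z hz hzR
    refine ⟨hR₁' z hz.1 ?_, ?_⟩
    · rw [mem_ball_zero_iff, not_lt]
      exact (le_max_left _ _).trans hzR
    · by_contra h0
      have := mem_ball_zero_iff.1 (hR₂ (subset_tsupport _ h0))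
      exact absurd ((le_max_right R₁ R₂).trans hzR) (not_le.2 this)
  have hP := contDiff_tailInt_none (s := s) hgt
  have hχ := isTest_cutoff (d := d) hR
  have hΦ := hχ.mul_left hP
  obtain ⟨S, hS, hSw, hPS⟩ := exists_isClosed_support_tailInt_none hgc hgs
  have hts : tsupport (fun z => tailInt s none g z * cutoff R z) ⊆ S :=
    closure_minimal ((Function.support_mul_subset_left _ _).trans hPS) hS
  -- With zero trace, Green's formula gives ∫ h · tail(g) = sign · ∫ w g. The duality formula gives
  -- the same value for the primitive of h in place of w.
  have hgreen := htr.green ha hW hΦ (hSw.mono_left hts)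
  simp only [Pi.zero_apply, zero_mul, integral_zero, mul_zero] at hgreen
  have hint1 : IntegrableOn (fun z => h z * tailInt s b g z) (s.domain b η) :=
    (hL.restrict _).integrable_mul (memLp_tailInt ha hgt.continuous hgc)
  have hint2 : IntegrableOn (fun z => w z * g z) (s.domain b η) :=
    LocL2.integrable_mul hΩ hW.memLp hgt.continuous hgc
  have hint3 : IntegrableOn (fun z => vertInt η h z * g z) (s.domain b η) :=
    hT.integrable_mul hΩ hgt.continuous hgc
  have hcongr : ∫ z in s.domain b η, ((W z).2 * (tailInt s none g z * cutoff R z) +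
        w z * fderiv ℝ (fun z => tailInt s none g z * cutoff R z) z (0, 1)) =
      ∫ z in s.domain b η, (h z * tailInt s b g z - s.sign * (w z * g z)) := by
    refine integral_congr_ae ?_
    filter_upwards [hh, ae_restrict_mem hΩ] with z hz hzΩ
    rw [hz, fderiv_mul_apply' (hP.differentiable (by simp)) hχ.differentiable,
      fderiv_tailInt_none hgt, tailInt_eq_tailInt_none hgs]
    rcases lt_or_ge ‖z‖ R with hzR | hzR
    · rw [cutoff_eq_one hR hzR.le, fderiv_cutoff_eq_zero hR hzR]
      simp only [zero_apply]
      ring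
    · obtain ⟨e1, e2⟩ := hout z hzΩ hzR
      rw [e1, e2]
      ring
  rw [hcongr, integral_sub hint1 (hint2.const_mul _), integral_const_mul] at hgreen
  have hfub := integral_vertInt_mul ha hm hL hgt.continuous hgc
  have e : ∀ z, g z • (w z - vertInt η h z) = w z * g z - vertInt η h z * g z := fun z => by
    rw [smul_eq_mul]; ring
  simp only [e]
  rw [integral_sub hint2 hint3, hfub, sub_eq_zero.1 hgreen, ← mul_assoc, s.sign_mul_self]
  ring

/-- Vertical primitives need a function that is defined everywhere and measurable on every vertical
line: a strongly measurable representative on Ω, extended by zero. -/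
theorem exists_stronglyMeasurable_snd {Ω : Set (Amb d)} (hΩ : MeasurableSet Ω)
    {W : Amb d → Amb d} (hW : MemLp W 2 (volume.restrict Ω)) :
    ∃ h : Amb d → ℝ, StronglyMeasurable h ∧ MemLp h 2 volume ∧
      ∀ᵐ z ∂(volume.restrict Ω), (W z).2 = h z := by
  have h1 : MemLp (fun z => (W z).2) 2 (volume.restrict Ω) :=
    (ContinuousLinearMap.snd ℝ (Hor d) ℝ).comp_memLp' hW
  refine ⟨Ω.indicator (h1.1.mk _), h1.1.stronglyMeasurable_mk.indicator hΩ, ?_, ?_⟩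
  · rw [memLp_indicator_iff_restrict hΩ]
    exact (memLp_congr_ae h1.1.ae_eq_mk).1 h1
  · filter_upwards [h1.1.ae_eq_mk, ae_restrict_mem hΩ] with z hz hzΩ
    rw [indicator_of_mem hzΩ, hz]

end Representation

/-! ### Removing the bounded support restriction -/

section Density

open Filter Topology

variable {s : Phase} {b : Option (Hor d → ℝ)} {η : Hor d → ℝ}

theorem tendsto_eLpNorm_indicator_compl_ball {X : Type*} [NormedAddCommGroup X]
    {μ : Measure (Amb d)} {F : Amb d → X} (hF : MemLp F 2 μ) :
    Tendsto (fun n : ℕ => eLpNorm ((Metric.ball (0 : Amb d) (n + 1))ᶜ.indicator F) 2 μ)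
      atTop (𝓝 0) := by
  have hsq : ∀ f : Amb d → X, eLpNorm f 2 μ = (∫⁻ z, ‖f z‖ₑ ^ 2 ∂μ) ^ (1 / 2 : ℝ) := fun f => by
    rw [eLpNorm_eq_lintegral_rpow_enorm_toReal two_ne_zero (by simp)]
    simp
  have hfin : ∫⁻ z, ‖F z‖ₑ ^ 2 ∂μ ≠ ⊤ := by
    intro h
    have := hF.2
    rw [hsq, h] at this
    simp at this
  have hlim : Tendsto (fun n : ℕ =>
      ∫⁻ z, ‖(Metric.ball (0 : Amb d) (n + 1))ᶜ.indicator F z‖ₑ ^ 2 ∂μ) atTop (𝓝 0) := by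
    rw [show (0 : ENNReal) = ∫⁻ _ : Amb d, 0 ∂μ by simp]
    refine tendsto_lintegral_of_dominated_convergence' (fun z => ‖F z‖ₑ ^ 2) (fun n => ?_)
      (fun n => Eventually.of_forall fun z => ?_) hfin (Eventually.of_forall fun z => ?_)
    · exact (hF.1.indicator Metric.isOpen_ball.measurableSet.compl).enorm.pow_const 2
    · dsimp only
      gcongr
      exact enorm_indicator_le_enorm_self F z
    · refine tendsto_const_nhds.congr' ?_
      obtain ⟨N, hN⟩ := exists_nat_gt ‖z‖
      filter_upwards [eventually_ge_atTop N] with n hn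
      have : z ∈ Metric.ball (0 : Amb d) (n + 1) := by
        rw [mem_ball_zero_iff]
        have : (N : ℝ) ≤ n := by exact_mod_cast hn
        linarith
      rw [indicator_of_notMem (by simpa using this)]
      simp
  simp only [hsq]
  have := (ENNReal.continuous_rpow_const (y := (1 / 2 : ℝ))).tendsto 0
  rw [ENNReal.zero_rpow_of_pos (by norm_num)] at this
  exact this.comp hlim

theorem abs_sub_le_of_lipschitzWith {K : NNReal} (hη : LipschitzWith K η) {R : ℝ}
    (hR : 1 ≤ R) (x : Hor d) (y : ℝ) (hx : ‖x‖ < R) (hy : |y| < R) :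
    |y - η x| ≤ R * (1 + K + |η 0|) := by
  have h1 : |η x - η 0| ≤ K * ‖x‖ := by
    simpa [Real.dist_eq] using hη.dist_le_mul x 0
  have h2 : |y - η x| ≤ |y| + |η x - η 0| + |η 0| := by
    calc |y - η x| = |y - (η x - η 0) - η 0| := by ring_nf
      _ ≤ |y - (η x - η 0)| + |η 0| := abs_sub _ _
      _ ≤ _ := by gcongr; exact abs_sub _ _
  have h3 : (K : ℝ) * ‖x‖ ≤ K * R := by gcongr
  nlinarith [abs_nonneg (η 0)]

/-- Functions with zero trace satisfy a Poincaré inequality on large balls. -/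
theorem HasTrace.exists_eLpNorm_indicator_ball_le (ha : Admissible s b η) {w : Amb d → ℝ}
    {W : Amb d → Amb d} (hW : IsFiniteEnergy (s.domain b η) w W) (htr : HasTrace s b η w 0) :
    ∃ (A : ℝ) (N : ENNReal), 0 ≤ A ∧ N ≠ ⊤ ∧ ∀ R ≥ 1,
      eLpNorm ((Metric.ball (0 : Amb d) R).indicator w) 2 (volume.restrict (s.domain b η)) ≤
        ENNReal.ofReal (R * A) * N := by
  obtain ⟨L, hη⟩ := ha.lipschitz_interface
  obtain ⟨h, hm, hL, hh⟩ := exists_stronglyMeasurable_snd (isOpen_domain ha).measurableSet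
    hW.memLp_grad
  have hrep := htr.ae_eq_vertInt ha hW.isH1Loc hm hL hh
  set B := 1 + (L : ℝ) + |η 0|
  have hB : 1 ≤ B := by
    have := abs_nonneg (η 0)
    have := L.2
    simp only [B]
    linarith
  -- On the ball of radius R ≥ 1 the vertical distance to the interface is at most RB, so the
  -- squared constant is 2R · RB, and this is at most (R · 2B)² because B ≥ 1.
  refine ⟨2 * B, eLpNorm h 2 volume, by positivity, hL.2.ne, fun R hR => ?_⟩
  have hR0 : 0 ≤ R := zero_le_one.trans hR
  calc eLpNorm ((Metric.ball (0 : Amb d) R).indicator w) 2 (volume.restrict (s.domain b η))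
      = eLpNorm ((Metric.ball (0 : Amb d) R).indicator (vertInt η h)) 2
          (volume.restrict (s.domain b η)) := by
        refine eLpNorm_congr_ae ?_
        filter_upwards [hrep] with z hz
        simp only [indicator, hz]
    _ ≤ eLpNorm ((Metric.ball (0 : Amb d) R).indicator (vertInt η h)) 2 volume :=
        eLpNorm_mono_measure _ Measure.restrict_le_self
    _ = eLpNorm (vertInt η h) 2 (volume.restrict (Metric.ball 0 R)) :=
        eLpNorm_indicator_eq_eLpNorm_restrict Metric.isOpen_ball.measurableSet
    _ ≤ _ := by
        refine eLpNorm_vertInt_le hm (by positivity)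
          (abs_sub_le_of_lipschitzWith hη hR) ?_
        have : B ≤ B ^ 2 := by nlinarith
        nlinarith [sq_nonneg R, sq_nonneg B]

/-- A square integrable field that is orthogonal to all gradients of functions of bounded support
with zero trace on the interface is orthogonal to all gradients of functions with zero trace. -/
theorem IsImpermeable.integral_dot_eq_zero (ha : Admissible s b η) {F : Amb d → Amb d}
    (hF : MemLp F 2 (volume.restrict (s.domain b η))) (himp : IsImpermeable s b η F)
    {w : Amb d → ℝ} {W : Amb d → Amb d} (hW : IsFiniteEnergy (s.domain b η) w W)
    (htr : HasTrace s b η w 0) : ∫ z in s.domain b η, dot (F z) (W z) = 0 := by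
  have hΩ := (isOpen_domain ha).measurableSet
  set μ := (volume : Measure (Amb d)).restrict (s.domain b η) with hμ
  have hpos : ∀ n : ℕ, (0 : ℝ) < n + 1 := fun n => by positivity
  have hFW : Integrable (fun z => dot (F z) (W z)) μ := hF.integrable_bilin hW.memLp_grad dotL
  have hm1 : ∀ n : ℕ, MemLp (fun z => cutoff (n + 1 : ℝ) z • W z) 2 μ := fun n =>
    LocL2.memLp_bilin_of_hasCompactSupport hΩ hW.isH1Loc.memLp_grad
      (ContinuousLinearMap.lsmul ℝ ℝ).flip (isTest_cutoff (hpos n)).continuous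
      (isTest_cutoff (hpos n)).2
  have hm2 : ∀ n : ℕ, MemLp (fun z => w z • grad (cutoff (n + 1 : ℝ)) z) 2 μ := fun n =>
    LocL2.memLp_bilin_of_hasCompactSupport hΩ hW.isH1Loc.memLp
      (ContinuousLinearMap.lsmul ℝ ℝ) (isTest_cutoff (hpos n)).continuous_grad
      (isTest_cutoff (hpos n)).hasCompactSupport_grad
  -- The truncated function χw has bounded support and zero trace, so F is orthogonal to its
  -- gradient χW + w∇χ. It remains to show that the commutator term w F · ∇χ disappears in the
  -- limit.
  have hsum : ∀ n : ℕ, ∫ z, cutoff (n + 1 : ℝ) z * dot (F z) (W z) ∂μ =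
      -∫ z, w z * fderiv ℝ (cutoff (n + 1 : ℝ)) z (F z) ∂μ := by
    intro n
    have h0 := himp _ _ (hW.mul_isTest hΩ (isTest_cutoff (hpos n)))
      (Metric.isBounded_closedBall.subset
        ((Function.support_mul_subset_left _ _).trans (support_cutoff_subset (hpos n))))
      (htr.mul_isTest ha (isTest_cutoff (hpos n)))
    have e1 : ∀ z, dot (F z) (cutoff (n + 1 : ℝ) z • W z) =
      cutoff (n + 1 : ℝ) z * dot (F z) (W z) := fun z => dot_smul_right _ _ _
    have e2 : ∀ z, dot (F z) (w z • grad (cutoff (n + 1 : ℝ)) z) =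
      w z * fderiv ℝ (cutoff (n + 1 : ℝ)) z (F z) := fun z => by
        rw [dot_smul_right, grad, dot_riesz_right]
    simp only [dot_add_right] at h0
    have i1 : Integrable (fun z => dot (F z) (cutoff (n + 1 : ℝ) z • W z)) μ :=
      hF.integrable_bilin (hm1 n) dotL
    have i2 : Integrable (fun z => dot (F z) (w z • grad (cutoff (n + 1 : ℝ)) z)) μ :=
      hF.integrable_bilin (hm2 n) dotL
    rw [integral_add i1 i2] at h0
    simp only [e1, e2] at h0
    linarith
  have hlim1 : Tendsto (fun n : ℕ => ∫ z, cutoff (n + 1 : ℝ) z * dot (F z) (W z) ∂μ) atTop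
      (𝓝 (∫ z, dot (F z) (W z) ∂μ)) := by
    refine tendsto_integral_of_dominated_convergence (fun z => ‖dot (F z) (W z)‖)
      (fun n => ?_) hFW.norm (fun n => Eventually.of_forall fun z => ?_)
      (Eventually.of_forall fun z => ?_)
    · exact (isTest_cutoff (hpos n)).continuous.aestronglyMeasurable.mul hFW.1
    · rw [norm_mul, Real.norm_eq_abs]
      exact mul_le_of_le_one_left (norm_nonneg _) (abs_cutoff_le _ _)
    · refine tendsto_const_nhds.congr' ?_
      obtain ⟨N, hN⟩ := exists_nat_gt ‖z‖
      filter_upwards [eventually_ge_atTop N] with n hn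
      have : (N : ℝ) ≤ n := by exact_mod_cast hn
      rw [cutoff_eq_one (hpos n) (by linarith), one_mul]
  obtain ⟨C, hC0, hC⟩ := exists_norm_fderiv_cutoff_le d
  obtain ⟨A, N, hA, hN, hAN⟩ := htr.exists_eLpNorm_indicator_ball_le ha hW
  -- ∇χ is of size C/R and lives where R ≤ ‖z‖ ≤ 2R; the open ball of radius 3R contains that set.
  -- The growth 3RA of the norm of w cancels 1/R, leaving 3CA times the L² tail of F.
  have hbound : ∀ n : ℕ, ‖∫ z, w z * fderiv ℝ (cutoff (n + 1 : ℝ)) z (F z) ∂μ‖ₑ ≤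
      ENNReal.ofReal (3 * C * A) * N *
        eLpNorm ((Metric.ball (0 : Amb d) (n + 1))ᶜ.indicator F) 2 μ := by
    intro n
    set R : ℝ := n + 1
    have hR : 1 ≤ R := by simp [R]
    have hR0 : 0 < R := hpos n
    have hpt : ∀ z, ‖w z * fderiv ℝ (cutoff R) z (F z)‖ₑ ≤ ENNReal.ofReal (C / R) *
        ‖((Metric.ball (0 : Amb d) (3 * R)).indicator w •
          (Metric.ball (0 : Amb d) R)ᶜ.indicator F) z‖ₑ := by
      intro z
      rw [← ofReal_norm, ← ofReal_norm, ← ENNReal.ofReal_mul (by positivity)]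
      refine ENNReal.ofReal_le_ofReal ?_
      by_cases hz1 : ‖z‖ < R
      · rw [fderiv_cutoff_eq_zero hR0 hz1]
        simp only [zero_apply, mul_zero, norm_zero]
        positivity
      by_cases hz2 : ‖z‖ < 3 * R
      · rw [Pi.smul_apply', indicator_of_mem (mem_ball_zero_iff.2 hz2),
          indicator_of_mem (by simpa using hz1), norm_mul, norm_smul]
        calc ‖w z‖ * ‖fderiv ℝ (cutoff R) z (F z)‖ ≤ ‖w z‖ * (C / R * ‖F z‖) := by
              gcongr
              exact (ContinuousLinearMap.le_opNorm _ _).trans (by gcongr; exact hC R hR0 z)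
          _ = _ := by ring
      · have : fderiv ℝ (cutoff R) z = 0 := by
          by_contra h0
          have h1 := support_fderiv_subset ℝ (show z ∈ Function.support (fderiv ℝ (cutoff R)) from h0)
          have h2 := closure_minimal (support_cutoff_subset hR0) Metric.isClosed_closedBall h1
          rw [mem_closedBall_zero_iff] at h2
          linarith
        rw [this]
        simp only [zero_apply, mul_zero, norm_zero]
        positivity
    calc ‖∫ z, w z * fderiv ℝ (cutoff R) z (F z) ∂μ‖ₑ
        ≤ ∫⁻ z, ‖w z * fderiv ℝ (cutoff R) z (F z)‖ₑ ∂μ := enorm_integral_le_lintegral_enorm _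
      _ ≤ ∫⁻ z, ENNReal.ofReal (C / R) * ‖((Metric.ball (0 : Amb d) (3 * R)).indicator w •
          (Metric.ball (0 : Amb d) R)ᶜ.indicator F) z‖ₑ ∂μ := lintegral_mono hpt
      _ = ENNReal.ofReal (C / R) * eLpNorm ((Metric.ball (0 : Amb d) (3 * R)).indicator w •
          (Metric.ball (0 : Amb d) R)ᶜ.indicator F) 1 μ := by
          rw [lintegral_const_mul' _ _ ENNReal.ofReal_ne_top, eLpNorm_one_eq_lintegral_enorm]
      _ ≤ ENNReal.ofReal (C / R) * (eLpNorm ((Metric.ball (0 : Amb d) (3 * R)).indicator w) 2 μ *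
          eLpNorm ((Metric.ball (0 : Amb d) R)ᶜ.indicator F) 2 μ) := by
          gcongr
          refine eLpNorm_smul_le_mul_eLpNorm
            (hF.1.indicator Metric.isOpen_ball.measurableSet.compl) ?_
          -- `IsH1Loc` records measurability of w only on bounded pieces of the fluid; the identity
          -- with `vertInt` supplies it on the whole domain.
          obtain ⟨h, hm, hL, hh⟩ := exists_stronglyMeasurable_snd hΩ hW.memLp_grad
          exact ((stronglyMeasurable_vertInt ha.continuous hm).aestronglyMeasurable.congr
            (EventuallyEq.symm (htr.ae_eq_vertInt ha hW.isH1Loc hm hL hh))).indicator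
              Metric.isOpen_ball.measurableSet
      _ ≤ ENNReal.ofReal (C / R) * (ENNReal.ofReal (3 * R * A) * N *
          eLpNorm ((Metric.ball (0 : Amb d) R)ᶜ.indicator F) 2 μ) := by
          gcongr
          exact hAN (3 * R) (by linarith)
      _ = _ := by
          rw [← mul_assoc, ← mul_assoc, ← ENNReal.ofReal_mul (by positivity)]
          congr 3
          field_simp
  have hlim2 : Tendsto (fun n : ℕ => -∫ z, w z * fderiv ℝ (cutoff (n + 1 : ℝ)) z (F z) ∂μ) atTop
      (𝓝 (-0)) := by
    refine Tendsto.neg ?_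
    rw [tendsto_zero_iff_enorm_tendsto_zero]
    refine tendsto_of_tendsto_of_tendsto_of_le_of_le tendsto_const_nhds ?_ (fun _ => zero_le)
      hbound
    have := ENNReal.Tendsto.const_mul (a := ENNReal.ofReal (3 * C * A) * N)
      (tendsto_eLpNorm_indicator_compl_ball hF)
      (Or.inr (ENNReal.mul_ne_top ENNReal.ofReal_ne_top hN))
    simpa using this
  simp only [hsum] at hlim1
  rw [neg_zero] at hlim2
  exact tendsto_nhds_unique hlim1 hlim2

end Density

/-! ### Existence and uniqueness of the variational solution -/

section Dirichlet

variable {s : Phase} {b : Option (Hor d → ℝ)} {η f f' : Hor d → ℝ}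

/-- The ambient space with its Euclidean norm. -/
abbrev EucAmb (d : ℕ) : Type := WithLp 2 (Hor d × ℝ)

/-- The identity from the ambient space to its Euclidean version. -/
def toEuc (d : ℕ) : Amb d ≃L[ℝ] EucAmb d :=
  (WithLp.prodContinuousLinearEquiv 2 ℝ (Hor d) ℝ).symm

/-- The product type `Amb d` carries the maximum norm, which does not come from an inner product.
After this change of norm, L² fields form a Hilbert space whose inner product integrates `dot`. -/
theorem inner_toEuc (v w : Amb d) : inner ℝ (toEuc d v) (toEuc d w) = dot v w := by
  rw [WithLp.prod_inner_apply]
  simp [toEuc, dot, mul_comm]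

/-- A square integrable field as an element of a Hilbert space. -/
def toL2 {μ : Measure (Amb d)} {F : Amb d → Amb d} (hF : MemLp F 2 μ) : Lp (EucAmb d) 2 μ :=
  MemLp.toLp _ ((toEuc d : Amb d →L[ℝ] EucAmb d).comp_memLp' hF)

theorem inner_toL2 {μ : Measure (Amb d)} {F G : Amb d → Amb d} (hF : MemLp F 2 μ)
    (hG : MemLp G 2 μ) : inner ℝ (toL2 hF) (toL2 hG) = ∫ z, dot (F z) (G z) ∂μ := by
  rw [L2.inner_def]
  refine integral_congr_ae ?_
  filter_upwards [MemLp.coeFn_toLp ((toEuc d : Amb d →L[ℝ] EucAmb d).comp_memLp' hF),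
    MemLp.coeFn_toLp ((toEuc d : Amb d →L[ℝ] EucAmb d).comp_memLp' hG)] with z h1 h2
  rw [toL2, toL2, h1, h2]
  exact inner_toEuc _ _

theorem exists_toL2_eq {μ : Measure (Amb d)} (W : Lp (EucAmb d) 2 μ) :
    ∃ (G : Amb d → Amb d) (hG : MemLp G 2 μ), toL2 hG = W := by
  refine ⟨fun z => (toEuc d).symm (W z),
    ((toEuc d).symm : EucAmb d →L[ℝ] Amb d).comp_memLp' (Lp.memLp W), ?_⟩
  refine Lp.ext ?_
  refine (MemLp.coeFn_toLp _).trans (Filter.Eventually.of_forall fun z => ?_)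
  simp

/-- The fields to which a gradient of a function with zero trace is orthogonal: they express that
its vertical primitive has this gradient. -/
def compatField (s : Phase) (b : Option (Hor d → ℝ)) (Φ : Amb d → ℝ) (v z : Amb d) : Amb d :=
  Φ z • v + (0, s.sign * tailInt s b (fun z => fderiv ℝ Φ z v) z)

theorem memLp_compatField (ha : Admissible s b η) {Φ : Amb d → ℝ} (hΦ : IsTest Φ) (v : Amb d) :
    MemLp (compatField s b Φ v) 2 (volume.restrict (s.domain b η)) := by
  have h1 : MemLp Φ 2 (volume.restrict (s.domain b η)) :=
    (hΦ.continuous.memLp_of_hasCompactSupport hΦ.2).restrict _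
  have h2 := memLp_tailInt ha (hΦ.fderiv_apply v).continuous (hΦ.fderiv_apply v).2
  refine MemLp.add
    (((ContinuousLinearMap.id ℝ ℝ).smulRight v).comp_memLp' h1) ?_
  exact (ContinuousLinearMap.inr ℝ (Hor d) ℝ).comp_memLp' (h2.const_mul s.sign)

/-- The right-hand side is the defect in the equation saying that the primitive of the vertical
component of W has derivative W · v. Duality moves the primitive onto the test function, so this
defect is an L² pairing with W. -/
theorem integral_dot_compatField (ha : Admissible s b η) {W : Amb d → Amb d}
    (hW : MemLp W 2 (volume.restrict (s.domain b η))) {h : Amb d → ℝ} (hm : StronglyMeasurable h)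
    (hL : MemLp h 2 volume) (hh : ∀ᵐ z ∂(volume.restrict (s.domain b η)), (W z).2 = h z)
    {Φ : Amb d → ℝ} (hΦ : IsTest Φ) (v : Amb d) :
    ∫ z in s.domain b η, dot (W z) (compatField s b Φ v z) =
      (∫ z in s.domain b η, dot (W z) v * Φ z) +
        ∫ z in s.domain b η, vertInt η h z * fderiv ℝ Φ z v := by
  have hΩ := (isOpen_domain ha).measurableSet
  have hv := hΦ.fderiv_apply v
  have i1 : IntegrableOn (fun z => dot (W z) v * Φ z) (s.domain b η) :=
    LocL2.integrable_dot_mul hΩ hW.locL2 v hΦ.continuous hΦ.2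
  have i2 : IntegrableOn (fun z => h z * tailInt s b (fun z => fderiv ℝ Φ z v) z)
      (s.domain b η) :=
    (hL.restrict _).integrable_mul (memLp_tailInt ha hv.continuous hv.2)
  rw [integral_vertInt_mul ha hm hL hv.continuous hv.2, ← integral_const_mul,
    ← integral_add i1 (i2.const_mul _)]
  refine integral_congr_ae ?_
  filter_upwards [hh] with z hz
  rw [compatField, dot_add_right, dot_smul_right, dot_vertical_right, hz]
  ring

theorem HasTrace.integral_dot_compatField_eq_zero (ha : Admissible s b η) {w : Amb d → ℝ}
    {W : Amb d → Amb d} (hW : IsFiniteEnergy (s.domain b η) w W) (htr : HasTrace s b η w 0)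
    {Φ : Amb d → ℝ} (hΦ : IsTest Φ) (hs : tsupport Φ ⊆ s.domain b η) (v : Amb d) :
    ∫ z in s.domain b η, dot (W z) (compatField s b Φ v z) = 0 := by
  obtain ⟨h, hm, hL, hh⟩ := exists_stronglyMeasurable_snd (isOpen_domain ha).measurableSet
    hW.memLp_grad
  have hrep := htr.ae_eq_vertInt ha hW.isH1Loc hm hL hh
  rw [integral_dot_compatField ha hW.memLp_grad hm hL hh hΦ]
  have h1 := hW.isH1Loc.weakGradient Φ hΦ hs v
  have h2 : ∫ z in s.domain b η, vertInt η h z * fderiv ℝ Φ z v =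
      ∫ z in s.domain b η, w z * fderiv ℝ Φ z v := by
    refine integral_congr_ae ?_
    filter_upwards [hrep] with z hz
    rw [hz]
  rw [h2, h1]
  ring

/-- The potential is the vertical primitive of the second component of W. With
`HasTrace.integral_dot_compatField_eq_zero` this identifies the gradients of zero-trace functions
with an orthogonal complement, so closedness comes for free. -/
theorem exists_zero_trace_of_compatField (ha : Admissible s b η) {W : Amb d → Amb d}
    (hW : MemLp W 2 (volume.restrict (s.domain b η)))
    (horth : ∀ Φ : Amb d → ℝ, IsTest Φ → tsupport Φ ⊆ s.domain b η → ∀ v : Amb d,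
      ∫ z in s.domain b η, dot (W z) (compatField s b Φ v z) = 0) :
    ∃ w, IsFiniteEnergy (s.domain b η) w W ∧ HasTrace s b η w 0 := by
  have hΩ := (isOpen_domain ha).measurableSet
  obtain ⟨h, hm, hL, hh⟩ := exists_stronglyMeasurable_snd hΩ hW
  have hT := locL2_vertInt ha.continuous hm hL (s.domain b η)
  have hw : IsH1Loc (s.domain b η) (vertInt η h) W := by
    refine ⟨hT, hW.locL2, fun Φ hΦ hs v => ?_⟩
    have := horth Φ hΦ hs v
    rw [integral_dot_compatField ha hW hm hL hh hΦ] at this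
    linarith
  refine ⟨vertInt η h, ⟨hw, hW⟩, locallyIntegrable_zero, W, hw, fun Φ hΦ hd => ?_⟩
  have hv := hΦ.fderiv_apply (0, 1)
  rw [integral_add (LocL2.integrable_mul hΩ hW.locL2.snd hΦ.continuous hΦ.2)
      (hT.integrable_mul hΩ hv.continuous hv.2),
    integral_vertInt_mul ha hm hL hv.continuous hv.2, ← integral_const_mul]
  have i2 : IntegrableOn (fun z => h z * tailInt s b (fun z => fderiv ℝ Φ z (0, 1)) z)
      (s.domain b η) :=
    (hL.restrict _).integrable_mul (memLp_tailInt ha hv.continuous hv.2)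
  simp only [Pi.zero_apply, zero_mul, integral_zero, mul_zero]
  rw [← integral_add (LocL2.integrable_mul hΩ hW.locL2.snd hΦ.continuous hΦ.2) (i2.const_mul _)]
  refine integral_eq_zero_of_ae ?_
  filter_upwards [hh, ae_restrict_mem hΩ] with z hz hzΩ
  -- As Φ vanishes near the wall, the tail integral of ∂_yΦ is ∓Φ, so the two terms of Green's
  -- formula cancel pointwise.
  rw [tailInt_fderiv hΦ hd hzΩ, hz, Pi.zero_apply]
  linear_combination (-(h z * Φ z)) * s.sign_mul_self

/-- P is the projection of x onto the orthogonal complement of S; it exists because that complement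
is closed. -/
theorem exists_orthogonal_decomposition {H : Type*} [NormedAddCommGroup H]
    [InnerProductSpace ℝ H] [CompleteSpace H] (S : Set H) (x : H) :
    ∃ P : H, (∀ k ∈ S, inner ℝ P k = 0) ∧
      ∀ w : H, (∀ k ∈ S, inner ℝ w k = 0) → inner ℝ (x - P) w = 0 := by
  have hmem : ∀ w : H, w ∈ (Submodule.span ℝ S)ᗮ ↔ ∀ k ∈ S, inner ℝ w k = 0 := by
    intro w
    rw [Submodule.mem_orthogonal']
    refine ⟨fun h k hk => h k (Submodule.subset_span hk), fun h u hu => ?_⟩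
    induction hu using Submodule.span_induction with
    | mem k hk => exact h k hk
    | zero => exact inner_zero_right _
    | add x y _ _ hx hy => rw [inner_add_right, hx, hy, add_zero]
    | smul a x _ hx => rw [inner_smul_right, hx, mul_zero]
  obtain ⟨P, hP, Q, hQ, hPQ⟩ := (Submodule.span ℝ S)ᗮ.exists_add_mem_mem_orthogonal x
  refine ⟨P, (hmem P).1 hP, fun w hw => ?_⟩
  rw [hPQ, add_sub_cancel_left]
  exact (Submodule.mem_orthogonal' _ _).1 hQ w ((hmem w).2 hw)

/-- Dirichlet's principle: take any finite-energy φ₀ with trace f and subtract the zero-trace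
function whose gradient is the L² projection of ∇φ₀ onto gradients of zero-trace functions. The
trace is unchanged and the remaining gradient is orthogonal to all of them. -/
theorem InDomain.exists_isDirichletSolution (ha : Admissible s b η) (hf : InDomain s b η f) :
    ∃ F φ, IsDirichletSolution s b η f φ F := by
  obtain ⟨φ₀, F₀, hφ₀, htr₀⟩ := hf
  have hΩ := (isOpen_domain ha).measurableSet
  obtain ⟨P, hP, hPw⟩ := exists_orthogonal_decomposition
    {k : Lp (EucAmb d) 2 (volume.restrict (s.domain b η)) | ∃ (Φ : Amb d → ℝ) (hΦ : IsTest Φ)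
      (v : Amb d), tsupport Φ ⊆ s.domain b η ∧ k = toL2 (memLp_compatField ha hΦ v)}
    (toL2 hφ₀.memLp_grad)
  obtain ⟨W, hW, rfl⟩ := exists_toL2_eq P
  obtain ⟨w, hw, hwtr⟩ := exists_zero_trace_of_compatField ha hW fun Φ hΦ hs v => by
    rw [← inner_toL2 hW (memLp_compatField ha hΦ v)]
    exact hP _ ⟨Φ, hΦ, v, hs, rfl⟩
  refine ⟨_, _, hφ₀.linear_combination hΩ hw 1 (-1), ?_, fun w₁ W₁ hw₁ htr₁ => ?_⟩
  · have := htr₀.linear_combination ha hwtr 1 (-1)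
    simpa using this
  · have h2 := hPw (toL2 hw₁.memLp_grad) fun k hk => by
      obtain ⟨Φ, hΦ, v, hs, rfl⟩ := hk
      rw [inner_toL2]
      exact htr₁.integral_dot_compatField_eq_zero ha hw₁ hΦ hs v
    rw [inner_sub_left, inner_toL2, inner_toL2] at h2
    have i1 : IntegrableOn (fun z => dot (F₀ z) (W₁ z)) (s.domain b η) :=
      hφ₀.memLp_grad.integrable_bilin hw₁.memLp_grad dotL
    have i2 : IntegrableOn (fun z => dot (W z) (W₁ z)) (s.domain b η) :=
      hW.integrable_bilin hw₁.memLp_grad dotL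
    rw [← integral_sub i1 i2] at h2
    rw [← h2]
    congr 1
    ext z
    rw [dot_add_left, dot_smul_left, dot_smul_left]
    ring

theorem ae_eq_of_integral_dot_sub_eq_zero {Ω : Set (Amb d)} {F F' : Amb d → Amb d}
    (hF : MemLp F 2 (volume.restrict Ω)) (hF' : MemLp F' 2 (volume.restrict Ω))
    (h : ∫ z in Ω, dot (F z) (F z - F' z) = 0) (h' : ∫ z in Ω, dot (F' z) (F z - F' z) = 0) :
    ∀ᵐ z ∂(volume.restrict Ω), F z = F' z := by
  have hD : MemLp (fun z => F z - F' z) 2 (volume.restrict Ω) := hF.sub hF'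
  have i1 : IntegrableOn (fun z => dot (F z) (F z - F' z)) Ω := hF.integrable_bilin hD dotL
  have i2 : IntegrableOn (fun z => dot (F' z) (F z - F' z)) Ω := hF'.integrable_bilin hD dotL
  have i3 : IntegrableOn (fun z => dot (F z - F' z) (F z - F' z)) Ω := hD.integrable_bilin hD dotL
  have e : ∫ z in Ω, dot (F z - F' z) (F z - F' z) = 0 := by
    simp only [dot_sub_left _ _ (_ - _)]
    rw [integral_sub i1 i2, h, h', sub_zero]
  rw [integral_eq_zero_iff_of_nonneg (fun z => dot_self_nonneg _) i3] at e
  filter_upwards [e] with z hz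
  exact sub_eq_zero.1 (dot_self_eq_zero hz)

theorem IsDirichletSolution.unique (ha : Admissible s b η) {φ φ' : Amb d → ℝ}
    {F F' : Amb d → Amb d} (h : IsDirichletSolution s b η f φ F)
    (h' : IsDirichletSolution s b η f φ' F') :
    ∀ᵐ z ∂(volume.restrict (s.domain b η)), F z = F' z := by
  have hΩ := (isOpen_domain ha).measurableSet
  have hw := h.finiteEnergy.linear_combination hΩ h'.finiteEnergy 1 (-1)
  have htr := h.trace.linear_combination ha h'.trace 1 (-1)
  simp only [one_smul, neg_one_smul, one_mul, neg_one_mul, ← sub_eq_add_neg, sub_self] at hw htr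
  exact ae_eq_of_integral_dot_sub_eq_zero h.finiteEnergy.memLp_grad h'.finiteEnergy.memLp_grad
    (h.variational _ _ hw htr) (h'.variational _ _ hw htr)

theorem IsDirichletSolution.inDomain {φ : Amb d → ℝ} {F : Amb d → Amb d}
    (h : IsDirichletSolution s b η f φ F) : InDomain s b η f :=
  ⟨φ, F, h.finiteEnergy, h.trace⟩

theorem exists_isDirichletSolution_potentialGradient (ha : Admissible s b η)
    (hf : InDomain s b η f) : ∃ φ, IsDirichletSolution s b η f φ (potentialGradient s b η f) :=
  Classical.epsilon_spec (hf.exists_isDirichletSolution ha)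

theorem IsDirichletSolution.const_mul (ha : Admissible s b η) {φ : Amb d → ℝ} {F : Amb d → Amb d}
    (h : IsDirichletSolution s b η f φ F) (c : ℝ) :
    IsDirichletSolution s b η (fun x => c * f x) (fun z => c * φ z) (fun z => c • F z) := by
  have hΩ := (isOpen_domain ha).measurableSet
  have h1 := h.finiteEnergy.linear_combination hΩ h.finiteEnergy c 0
  have h2 := h.trace.linear_combination ha h.trace c 0
  simp only [zero_smul, zero_mul, add_zero] at h1 h2
  refine ⟨h1, h2, fun w W hw htr => ?_⟩
  simp only [dot_smul_left, integral_const_mul, h.variational w W hw htr, mul_zero]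

/-- Both traces use the same chosen extension of ψ, so the identity is that of the integrands;
independence of the extension is not involved. -/
theorem normalTrace_const_smul_congr {F G : Amb d → Amb d}
    {c : ℝ} (h : ∀ᵐ z ∂(volume.restrict (s.domain b η)), F z = c • G z) :
    normalTrace s b η F = c • normalTrace s b η G := by
  ext ψ
  have : ∫ z in s.domain b η, fderiv ℝ (extension b η ψ) z (F z) =
      c * ∫ z in s.domain b η, fderiv ℝ (extension b η ψ) z (G z) := by
    rw [← integral_const_mul]
    refine integral_congr_ae ?_
    filter_upwards [h] with z hz
    rw [hz, map_smul, smul_eq_mul]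
  simp only [normalTrace, Pi.smul_apply, smul_eq_mul, this]
  ring

theorem IsDirichletSolution.normalTrace_eq (ha : Admissible s b η) {φ : Amb d → ℝ}
    {F u : Amb d → Amb d} (h : IsDirichletSolution s b η f φ F) {c : ℝ}
    (hu : ∀ᵐ z ∂(volume.restrict (s.domain b η)), u z = c • F z) :
    normalTrace s b η u = c • dirichletNeumann s b η f := by
  obtain ⟨φ', h'⟩ := exists_isDirichletSolution_potentialGradient ha h.inDomain
  refine normalTrace_const_smul_congr ?_
  filter_upwards [hu, h.unique ha h'] with z h1 h2
  rw [h1, h2]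

theorem dirichletNeumann_const_mul (ha : Admissible s b η) (hf : InDomain s b η f) (c : ℝ) :
    dirichletNeumann s b η (fun x => c * f x) = c • dirichletNeumann s b η f := by
  obtain ⟨φ, h⟩ := exists_isDirichletSolution_potentialGradient ha hf
  obtain ⟨φ', h'⟩ := exists_isDirichletSolution_potentialGradient ha (h.const_mul ha c).inDomain
  refine normalTrace_const_smul_congr ?_
  exact h'.unique ha (h.const_mul ha c)

/-! ### Darcy flows are potential flows -/

/-- The potential is φ = p + ρy. Its gradient P + ρe_y equals -μu, so it is globally square
integrable, although P alone is required to be so only locally. -/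
theorem IsDarcyFlow.exists_isDirichletSolution (ha : Admissible s b η) {μ ρ : ℝ} (hμ : μ ≠ 0)
    {u : Amb d → Amb d} {p : Amb d → ℝ} {g : Hor d → ℝ} (h : IsDarcyFlow s b η μ ρ u p)
    (htr : HasTrace s b η p g) :
    ∃ φ F, IsDirichletSolution s b η (fun x => g x + ρ * η x) φ F ∧
      ∀ᵐ z ∂(volume.restrict (s.domain b η)), u z = (-(1 / μ)) • F z := by
  have hΩ := (isOpen_domain ha).measurableSet
  obtain ⟨P, hP, hd⟩ := h.darcy
  have h1 := hP.linear_combination hΩ (isH1Loc_of_contDiff hΩ (contDiff_snd (n := ∞))) 1 ρ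
  have htr1 := htr.linear_combination ha (hasTrace_of_contDiff ha (contDiff_snd (n := ∞))) 1 ρ
  simp only [one_smul, one_mul, grad_snd] at h1 htr1
  have hFu : ∀ᵐ z ∂(volume.restrict (s.domain b η)),
      P z + ρ • ((0, 1) : Amb d) = (-μ) • u z := by
    filter_upwards [hd] with z hz
    rw [← eq_sub_iff_add_eq'] at hz
    rw [hz]
    ext1 <;> simp
    abel
  have hF2 : MemLp (fun z => P z + ρ • ((0, 1) : Amb d)) 2 (volume.restrict (s.domain b η)) :=
    (memLp_congr_ae hFu).2 (h.memLp.const_smul (-μ))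
  refine ⟨_, _, ⟨⟨h1, hF2⟩, htr1, fun w W hw hw0 => ?_⟩, ?_⟩
  · have : ∫ z in s.domain b η, dot (P z + ρ • ((0, 1) : Amb d)) (W z) =
        -μ * ∫ z in s.domain b η, dot (u z) (W z) := by
      rw [← integral_const_mul]
      refine integral_congr_ae ?_
      filter_upwards [hFu] with z hz
      rw [hz, dot_smul_left]
    rw [this, h.noPenetration.integral_dot_eq_zero ha h.memLp hw hw0, mul_zero]
  · filter_upwards [hFu] with z hz
    rw [hz, smul_smul]
    have : -(1 / μ) * -μ = 1 := by field_simp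
    rw [this, one_smul]

theorem IsDirichletSolution.isDarcyFlow (ha : Admissible s b η) {μ : ℝ} (hμ : μ ≠ 0) (ρ : ℝ)
    {φ : Amb d → ℝ} {F : Amb d → Amb d} (h : IsDirichletSolution s b η f φ F) :
    IsDarcyFlow s b η μ ρ (fun z => (-(1 / μ)) • F z) (fun z => φ z - ρ * z.2) ∧
      HasTrace s b η (fun z => φ z - ρ * z.2) (fun x => f x - ρ * η x) := by
  have hΩ := (isOpen_domain ha).measurableSet
  have h1 := h.finiteEnergy.isH1Loc.linear_combination hΩ
    (isH1Loc_of_contDiff hΩ (contDiff_snd (n := ∞))) 1 (-ρ)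
  have htr := h.trace.linear_combination ha
    (hasTrace_of_contDiff ha (contDiff_snd (n := ∞))) 1 (-ρ)
  simp only [one_smul, one_mul, grad_snd, neg_mul, ← sub_eq_add_neg] at h1 htr
  refine ⟨⟨h.finiteEnergy.memLp_grad.const_smul (-(1 / μ)), ⟨_, h1, ?_⟩, fun Φ hΦ hs => ?_,
    fun w W hw _ htr => ?_⟩, htr⟩
  · refine Filter.Eventually.of_forall fun z => ?_
    have : μ * -(1 / μ) = -1 := by field_simp
    rw [smul_smul, this]
    ext1 <;> simp
  -- A test function supported in the fluid is an admissible variation; this gives div u = 0.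
  · have := h.variational Φ (grad Φ) (hΦ.isFiniteEnergy hΩ) (hΦ.hasTrace_zero hΩ hs)
    simp only [grad, dot_riesz_right] at this
    simp only [map_smul, smul_eq_mul, integral_const_mul, this, mul_zero]
  · simp only [dot_smul_left, integral_const_mul, h.variational w W hw htr, mul_zero]

end Dirichlet

end Muskat

end

/-! ### The two equivalences -/

open Muskat in
theorem proposition2p1 (d : ℕ) (hd : 1 ≤ d) (I : Set ℝ) (hI : I.OrdConnected)
    (hI' : I.Nontrivial) (η : ℝ → Hor d → ℝ) (bm : Option (Hor d → ℝ))
    (hm : ∀ t ∈ I, Admissible .lower bm (η t)) :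
    -- one phase
    (∀ μm ρm : ℝ, 0 < μm → 0 < ρm →
      (∀ u p, SolvesOnePhase μm ρm bm I u p η → SolvesOnePhaseEq (ρm / μm) bm I η) ∧
      (SolvesOnePhaseEq (ρm / μm) bm I η → ∃ u p, SolvesOnePhase μm ρm bm I u p η)) ∧
    -- two phases
    (∀ (μp μm ρp ρm : ℝ) (bp : Option (Hor d → ℝ)), 0 < μp → 0 < μm →
      (∀ t ∈ I, Admissible .upper bp (η t)) →
      (∀ up um pp pm, SolvesTwoPhase μp μm ρp ρm bp bm I up um pp pm η →
        ∀ gp gm : ℝ → Hor d → ℝ,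
          (∀ t ∈ I, HasTrace .upper bp (η t) (pp t) (gp t)) →
          (∀ t ∈ I, HasTrace .lower bm (η t) (pm t) (gm t)) →
          SolvesTwoPhaseEq μp μm ρp ρm bp bm I η
            (fun t x => gp t x + ρp * η t x) (fun t x => gm t x + ρm * η t x)) ∧
      (∀ fp fm, SolvesTwoPhaseEq μp μm ρp ρm bp bm I η fp fm →
        ∃ up um pp pm, SolvesTwoPhase μp μm ρp ρm bp bm I up um pp pm η)) := by
  refine ⟨fun μm ρm hμ hρ => ⟨fun u p h t ht => ?_, fun h => ?_⟩,
    fun μp μm ρp ρm bp hμp hμm hp => ⟨fun up um pp pm h gp gm hgp hgm t ht => ?_,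
      fun fp fm h => ?_⟩⟩
  · obtain ⟨hflow, htr, hder⟩ := h t ht
    have ha := hm t ht
    obtain ⟨φ, F, hsol, hu⟩ := hflow.exists_isDirichletSolution ha hμ.ne' htr
    simp only [Pi.zero_apply, zero_add] at hsol
    -- The flow only provides a solution with trace ρη; dividing by ρ > 0 puts η itself in the
    -- domain.
    have hdom : InDomain .lower bm (η t) (η t) := by
      have := (hsol.const_mul ha ρm⁻¹).inDomain
      simpa only [inv_mul_cancel_left₀ hρ.ne'] using this
    refine ⟨hdom, _, hder, ?_⟩
    rw [hsol.normalTrace_eq ha hu, dirichletNeumann_const_mul ha hdom, smul_smul, ← add_smul]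
    have : -(1 / μm) * ρm + ρm / μm = 0 := by ring
    rw [this, zero_smul]
  -- The condition t ∈ I sits inside the existential so that `choose` gives u and p for all real
  -- times; off I they are set to 0.
  · have key : ∀ t, ∃ u p, t ∈ I → IsDarcyFlow .lower bm (η t) μm ρm u p ∧
        HasTrace .lower bm (η t) p 0 ∧ HasTimeDeriv I η t (normalTrace .lower bm (η t) u) := by
      intro t
      by_cases ht : t ∈ I
      swap
      · exact ⟨0, 0, fun h => absurd h ht⟩
      have ha := hm t ht
      obtain ⟨hdom, v, hv, hveq⟩ := h t ht
      obtain ⟨φ, hφ⟩ := exists_isDirichletSolution_potentialGradient ha hdom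
      have hsol := hφ.const_mul ha ρm
      obtain ⟨hflow, htr⟩ := hsol.isDarcyFlow ha hμ.ne' ρm
      refine ⟨_, _, fun _ => ⟨hflow, ?_, ?_⟩⟩
      · convert htr using 1
        ext x
        simp
      · rw [hsol.normalTrace_eq ha (Filter.Eventually.of_forall fun _ => rfl),
          dirichletNeumann_const_mul ha hdom, smul_smul]
        convert hv using 1
        rw [eq_neg_of_add_eq_zero_left hveq, ← neg_smul]
        congr 1
        ring
    choose u p hup using key
    exact ⟨u, p, hup⟩
  · obtain ⟨hflowp, hflowm, hnt, ⟨g, hgp', hgm'⟩, hder⟩ := h t ht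
    have hap := hp t ht
    have ham := hm t ht
    obtain ⟨φp, Fp, hsolp, hup⟩ := hflowp.exists_isDirichletSolution hap hμp.ne' (hgp t ht)
    obtain ⟨φm, Fm, hsolm, hum⟩ := hflowm.exists_isDirichletSolution ham hμm.ne' (hgm t ht)
    have ep := hsolp.normalTrace_eq hap hup
    have em := hsolm.normalTrace_eq ham hum
    refine ⟨hsolp.inDomain, hsolm.inDomain, ?_, ?_, ?_⟩
    · rw [em, neg_smul] at hder
      exact hder
    -- Pressure continuity provides one common trace g; uniqueness identifies both prescribed traces
    -- with it almost everywhere.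
    · filter_upwards [(hgp t ht).unique hap hgp', (hgm t ht).unique ham hgm'] with x h1 h2
      rw [h1, h2]
      ring
    · rw [ep, em, neg_smul, neg_smul, neg_inj] at hnt
      rw [hnt, sub_self]
  · have key : ∀ t, ∃ up um pp pm, t ∈ I →
        IsDarcyFlow .upper bp (η t) μp ρp up pp ∧ IsDarcyFlow .lower bm (η t) μm ρm um pm ∧
        normalTrace .upper bp (η t) up = normalTrace .lower bm (η t) um ∧
        (∃ g, HasTrace .upper bp (η t) pp g ∧ HasTrace .lower bm (η t) pm g) ∧
        HasTimeDeriv I η t (normalTrace .lower bm (η t) um) := by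
      intro t
      by_cases ht : t ∈ I
      swap
      · exact ⟨0, 0, 0, 0, fun h => absurd h ht⟩
      have hap := hp t ht
      have ham := hm t ht
      obtain ⟨hdp, hdm, hder, hjump, hflux⟩ := h t ht
      obtain ⟨φp, hsolp⟩ := exists_isDirichletSolution_potentialGradient hap hdp
      obtain ⟨φm, hsolm⟩ := exists_isDirichletSolution_potentialGradient ham hdm
      obtain ⟨hflowp, htrp⟩ := hsolp.isDarcyFlow hap hμp.ne' ρp
      obtain ⟨hflowm, htrm⟩ := hsolm.isDarcyFlow ham hμm.ne' ρm
      -- The common pressure trace is f⁺ - ρ⁺η, which agrees a.e. with f⁻ - ρ⁻η by the jump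
      -- condition.
      refine ⟨_, _, _, _, fun _ => ⟨hflowp, hflowm, ?_, ⟨_, htrp, htrm.congr_ae ?_⟩, ?_⟩⟩
      · rw [hsolp.normalTrace_eq hap (Filter.Eventually.of_forall fun _ => rfl),
          hsolm.normalTrace_eq ham (Filter.Eventually.of_forall fun _ => rfl), neg_smul, neg_smul,
          sub_eq_zero.1 hflux]
      · filter_upwards [hjump] with x hx
        linarith
      · rw [hsolm.normalTrace_eq ham (Filter.Eventually.of_forall fun _ => rfl), neg_smul]
        exact hder
    choose up um pp pm hup using key
    exact ⟨up, um, pp, pm, hup⟩
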